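/- Let $p\ge 3$ be a prime and let $G\cong\mathbb Z_p^\times$ (as topological groups), written as an internal direct product $G=\Gamma\times\Delta$ with $\Gamma$ open, $\Gamma\cong\mathbb Z_p$ and $\Delta\cong(\mathbb Z/p)^\times$. For a profinite group $H$ let $\Lambda(H)=\varprojlim_N\mathbb Z_p[H/N]$, $N$ running over the open normal subgroups of $H$, be its Iwasawa algebra. For a finitely generated $\Lambda(G)$-module $N$ let $H_i(G,N)$ be the left derived functors of the $G$-coinvariants $N\mapsto N_G=N/I(G)N$, where $I(G)$ is the kernel of the augmentation $\Lambda(G)\to\mathbb Z_p$. One says that $N$ has finite homological rank if every $H_i(G,N)$ has finite $\mathbb Z_p$-rank and only finitely many of these ranks are non-zero; then $$\operatorname{hmrank}_{\Lambda(G)}(N)=\sum_{i\ge 0}(-1)^i\operatorname{rank}_{\mathbb Z_p}H_i(G,N).$$ For a finitely generated $\Lambda(\Gamma)$-module $N$ let $\operatorname{rank}_{\Lambda(\Gamma)}(N)=\dim_K(K\otimes_{\Lambda(\Gamma)}N)$, where $K$ is the field of fractions of $\Lambda(\Gamma)$. Let $M$ be a finitely generated $\Lambda(G)$-module and let $\chi:\Delta\to\mathbb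 Z_p^\times$ be any character (in particular, any primitive one). Let $\mathbb Z_p(\chi)$ be $\mathbb Z_p$ with $G$ acting through $G\to\Delta\xrightarrow{\chi}\mathbb Z_p^\times$, let $G$ act diagonally on $M\otimes_{\mathbb Z_p}\mathbb Z_p(\chi)$, and let $M^{\chi^{-1}}=\{m\in M:\delta m=\chi(\delta)^{-1}m\text{ for all }\delta\in\Delta\}$. Then $M\otimes_{\mathbb Z_p}\mathbb Z_p(\chi)$ has finite homological rank, $M^{\chi^{-1}}$ is a finitely generated $\Lambda(\Gamma)$-module, and $$\operatorname{hmrank}_{\Lambda(G)}\bigl(M\otimes_{\mathbb Z_p}\mathbb Z_p(\chi)\bigr)=\operatorname{rank}_{\Lambda(\Gamma)}\bigl(M^{\chi^{-1}}\bigr).$$ -/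

import Mathlib

open CategoryTheory
open scoped TensorProduct

universe u v w

namespace Iwasawa

noncomputable section

section Algebra

variable (p : ℕ) [Fact p.Prime] (G : Type u) [Group G] [TopologicalSpace G]

/-- The canonical projection `ℤ_p[G/N] → ℤ_p[G/N']` for `N ≤ N'`. -/
def transition {N N' : OpenNormalSubgroup G} (h : N.toSubgroup ≤ N'.toSubgroup) :
    MonoidAlgebra ℤ_[p] (G ⧸ N.toSubgroup) →ₐ[ℤ_[p]] MonoidAlgebra ℤ_[p] (G ⧸ N'.toSubgroup) :=
  MonoidAlgebra.mapDomainAlgHom ℤ_[p] ℤ_[p]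
    (QuotientGroup.map N.toSubgroup N'.toSubgroup (MonoidHom.id G) h)

/-- The compatible families in the product of the `ℤ_p[G/N]`, `N` open normal in `G`. -/
def compatibleFamilies :
    Subalgebra ℤ_[p] ((N : OpenNormalSubgroup G) → MonoidAlgebra ℤ_[p] (G ⧸ N.toSubgroup)) where
  carrier := {x | ∀ (N N' : OpenNormalSubgroup G) (h : N.toSubgroup ≤ N'.toSubgroup),
    transition p G h (x N) = x N'}
  mul_mem' hx hy N N' h := by
    rw [Pi.mul_apply, Pi.mul_apply, map_mul, hx N N' h, hy N N' h]
  add_mem' hx hy N N' h := by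
    rw [Pi.add_apply, Pi.add_apply, map_add, hx N N' h, hy N N' h]
  algebraMap_mem' r N N' h := by
    rw [Pi.algebraMap_apply, Pi.algebraMap_apply, AlgHom.commutes]

/-- The Iwasawa algebra `Λ(G) = lim ℤ_p[G/N]`, over the open normal subgroups `N` of `G`. -/
def IwasawaAlgebra : Type u := compatibleFamilies p G

instance : Ring (IwasawaAlgebra p G) := inferInstanceAs (Ring (compatibleFamilies p G))

instance : Algebra ℤ_[p] (IwasawaAlgebra p G) :=
  inferInstanceAs (Algebra ℤ_[p] (compatibleFamilies p G))

variable {G}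

/-- The projection `Λ(G) → ℤ_p[G/N]`. -/
def proj (N : OpenNormalSubgroup G) :
    IwasawaAlgebra p G →ₐ[ℤ_[p]] MonoidAlgebra ℤ_[p] (G ⧸ N.toSubgroup) :=
  (Pi.evalAlgHom ℤ_[p] _ N).comp (compatibleFamilies p G).val

variable {p}

theorem ext_proj {x y : IwasawaAlgebra p G} (h : ∀ N, proj p N x = proj p N y) : x = y :=
  Subtype.ext (funext h)

theorem transition_proj {N N' : OpenNormalSubgroup G} (h : N.toSubgroup ≤ N'.toSubgroup)
    (x : IwasawaAlgebra p G) : transition p G h (proj p N x) = proj p N' x :=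
  x.2 N N' h

/-- The universal property of the limit. -/
def liftProj {A : Type*} [Semiring A] [Algebra ℤ_[p] A]
    (f : (N : OpenNormalSubgroup G) → A →ₐ[ℤ_[p]] MonoidAlgebra ℤ_[p] (G ⧸ N.toSubgroup))
    (hf : ∀ (N N' : OpenNormalSubgroup G) (h : N.toSubgroup ≤ N'.toSubgroup) (a : A),
      transition p G h (f N a) = f N' a) :
    A →ₐ[ℤ_[p]] IwasawaAlgebra p G :=
  (AlgHom.pi f).codRestrict (compatibleFamilies p G) fun a N N' h => hf N N' h a

theorem proj_liftProj {A : Type*} [Semiring A] [Algebra ℤ_[p] A]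
    (f : (N : OpenNormalSubgroup G) → A →ₐ[ℤ_[p]] MonoidAlgebra ℤ_[p] (G ⧸ N.toSubgroup))
    (hf : ∀ (N N' : OpenNormalSubgroup G) (h : N.toSubgroup ≤ N'.toSubgroup) (a : A),
      transition p G h (f N a) = f N' a) (N : OpenNormalSubgroup G) (a : A) :
    proj p N (liftProj f hf a) = f N a := rfl

variable (p)

/-- The canonical map `G → Λ(G)`, sending `g` to the family of its classes. -/
def of : G →* IwasawaAlgebra p G where
  toFun g := ⟨fun N => MonoidAlgebra.of ℤ_[p] (G ⧸ N.toSubgroup) (QuotientGroup.mk g),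
    fun N N' h => by
      simp only [transition, MonoidAlgebra.of_apply, MonoidAlgebra.mapDomainAlgHom_apply,
        MonoidAlgebra.mapDomain_single]
      rfl⟩
  map_one' := Subtype.ext (funext fun N => map_one (MonoidAlgebra.of ℤ_[p] (G ⧸ N.toSubgroup)))
  map_mul' a b := Subtype.ext (funext fun N =>
    map_mul (MonoidAlgebra.of ℤ_[p] (G ⧸ N.toSubgroup)) (a : G ⧸ N.toSubgroup) b)

theorem proj_of (N : OpenNormalSubgroup G) (g : G) :
    proj p N (of p g) = MonoidAlgebra.of ℤ_[p] (G ⧸ N.toSubgroup) (QuotientGroup.mk g) := rfl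

variable (G)

/-- `G` as an open normal subgroup of itself. -/
def topSubgroup : OpenNormalSubgroup G where
  toSubgroup := ⊤
  isOpen' := isOpen_univ
  isNormal' := inferInstanceAs (⊤ : Subgroup G).Normal

/-- The augmentation `Λ(G) → ℤ_p`, `g ↦ 1`. -/
def augmentation : IwasawaAlgebra p G →ₐ[ℤ_[p]] ℤ_[p] :=
  (MonoidAlgebra.lift ℤ_[p] ℤ_[p] (G ⧸ (topSubgroup G).toSubgroup) 1).comp
    (proj p (topSubgroup G))

/-- The augmentation ideal `I(G)`, as a left ideal of `Λ(G)`. -/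
def augmentationIdeal : Ideal (IwasawaAlgebra p G) := RingHom.ker (augmentation p G)

variable {G} {H : Type w} [Group H] [TopologicalSpace H]

/-- The preimage of an open normal subgroup under a continuous homomorphism. -/
def comapSubgroup (f : H →ₜ* G) (N : OpenNormalSubgroup G) : OpenNormalSubgroup H where
  toOpenSubgroup := N.toOpenSubgroup.comap f.toMonoidHom f.continuous_toFun
  isNormal' := inferInstanceAs (N.toSubgroup.comap f.toMonoidHom).Normal

/-- The ring homomorphism `Λ(H) → Λ(G)` induced by a continuous homomorphism `H → G`. -/
def map (f : H →ₜ* G) : IwasawaAlgebra p H →ₐ[ℤ_[p]] IwasawaAlgebra p G :=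
  liftProj (fun N => (MonoidAlgebra.mapDomainAlgHom ℤ_[p] ℤ_[p]
      (QuotientGroup.map (comapSubgroup f N).toSubgroup N.toSubgroup f.toMonoidHom le_rfl)).comp
      (proj p (comapSubgroup f N))) fun N N' h a => by
    have h' : (comapSubgroup f N).toSubgroup ≤ (comapSubgroup f N').toSubgroup := fun x hx => h hx
    rw [AlgHom.comp_apply, AlgHom.comp_apply, ← transition_proj h' a]
    generalize proj p (comapSubgroup f N) a = b
    induction b using MonoidAlgebra.induction_linear with
    | zero => simp
    | add x y hx hy => simp only [map_add, hx, hy]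
    | single x r =>
      induction x using QuotientGroup.induction_on
      simp only [transition, MonoidAlgebra.mapDomainAlgHom_apply, MonoidAlgebra.mapDomain_single]
      rfl

theorem map_of (f : H →ₜ* G) (h : H) : map p f (of p h) = of p (f h) :=
  ext_proj fun N => by
    rw [map, proj_liftProj, AlgHom.comp_apply, proj_of, proj_of, MonoidAlgebra.of_apply,
      MonoidAlgebra.mapDomainAlgHom_apply, MonoidAlgebra.mapDomain_single]
    rfl

theorem augmentation_of (g : G) : augmentation p G (of p g) = 1 := by
  rw [augmentation, AlgHom.comp_apply, proj_of, MonoidAlgebra.lift_of, MonoidHom.one_apply]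

end Algebra

section Homology

variable (p : ℕ) [Fact p.Prime] (G : Type u) [Group G] [TopologicalSpace G]

/-- The functor of `G`-coinvariants `M ↦ M_G = M / I(G)M`, from `Λ(G)`-modules to
`ℤ_p`-modules. -/
def coinvariants : ModuleCat.{v} (IwasawaAlgebra p G) ⥤ ModuleCat.{v} ℤ_[p] where
  obj M := (ModuleCat.restrictScalars (algebraMap ℤ_[p] (IwasawaAlgebra p G))).obj
    (ModuleCat.of (IwasawaAlgebra p G)
      (M ⧸ (augmentationIdeal p G • ⊤ : Submodule (IwasawaAlgebra p G) M)))
  map f := (ModuleCat.restrictScalars (algebraMap ℤ_[p] (IwasawaAlgebra p G))).map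
    (ModuleCat.ofHom (Submodule.mapQ _ _ f.hom (by
      rw [← Submodule.map_le_iff_le_comap, Submodule.map_smul'']
      exact smul_mono_right _ le_top)))
  map_id M := by
    ext x
    obtain ⟨x, rfl⟩ := Submodule.Quotient.mk_surjective _ x
    rfl
  map_comp f g := by
    ext x
    obtain ⟨x, rfl⟩ := Submodule.Quotient.mk_surjective _ x
    rfl

instance : (coinvariants.{u, v} p G).Additive where
  map_add {M N f g} := by
    ext x
    obtain ⟨x, rfl⟩ := Submodule.Quotient.mk_surjective _ x
    rfl

variable [Small.{v} (IwasawaAlgebra p G)] (M : Type v) [AddCommGroup M]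
  [Module (IwasawaAlgebra p G) M]

/-- The homology `H_i(G, M)`: the left derived functors of the coinvariants. -/
def homology (i : ℕ) : ModuleCat.{v} ℤ_[p] :=
  ((coinvariants.{u, v} p G).leftDerived i).obj (ModuleCat.of (IwasawaAlgebra p G) M)

/-- All the `H_i(G, M)` have finite `ℤ_p`-rank, and all but finitely many have rank zero. -/
def HasFiniteHomologicalRank : Prop :=
  (∀ i, Module.rank ℤ_[p] (homology p G M i) < Cardinal.aleph0) ∧
    {i | Module.rank ℤ_[p] (homology p G M i) ≠ 0}.Finite

/-- The homological rank `∑ i, (-1)^i rank_{ℤ_p} H_i(G, M)`; it is meaningful when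
`HasFiniteHomologicalRank` holds. -/
def hmrank : ℤ := ∑ᶠ i : ℕ, (-1) ^ i * (Module.finrank ℤ_[p] (homology p G M i) : ℤ)

end Homology

section Twist

variable (p : ℕ) [Fact p.Prime] (G : Type u) [Group G] [TopologicalSpace G]

/-- A character `G → ℤ_p^×` with open kernel. -/
structure OpenChar where
  /-- the underlying homomorphism -/
  toHom : G →* ℤ_[p]ˣ
  isOpen_ker : IsOpen (toHom.ker : Set G)

variable {p G} (ψ : OpenChar p G)

/-- The open normal subgroup `N ∩ ker ψ`. -/
def infKer (N : OpenNormalSubgroup G) : OpenNormalSubgroup G where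
  toSubgroup := N.toSubgroup ⊓ ψ.toHom.ker
  isOpen' := N.isOpen'.inter ψ.isOpen_ker
  isNormal' := inferInstanceAs (N.toSubgroup ⊓ ψ.toHom.ker).Normal

/-- The homomorphism `ℤ_p[G/(N ∩ ker ψ)] → ℤ_p[G/N]`, `g ↦ ψ(g) g`. -/
def twistLevel (N : OpenNormalSubgroup G) :
    MonoidAlgebra ℤ_[p] (G ⧸ (infKer ψ N).toSubgroup) →ₐ[ℤ_[p]]
      MonoidAlgebra ℤ_[p] (G ⧸ N.toSubgroup) :=
  MonoidAlgebra.lift ℤ_[p] (MonoidAlgebra ℤ_[p] (G ⧸ N.toSubgroup))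
    (G ⧸ (infKer ψ N).toSubgroup) <|
    QuotientGroup.lift (infKer ψ N).toSubgroup
      { toFun := fun g => MonoidAlgebra.single (g : G ⧸ N.toSubgroup) (ψ.toHom g : ℤ_[p])
        map_one' := by rw [map_one]; rfl
        map_mul' := fun a b => by
          rw [MonoidAlgebra.single_mul_single, map_mul, Units.val_mul]; rfl } <| by
      rintro g ⟨h1, h2⟩
      have h3 : (g : G ⧸ N.toSubgroup) = 1 := (QuotientGroup.eq_one_iff g).2 h1
      have h4 : ψ.toHom g = 1 := h2
      simp [h3, h4, MonoidAlgebra.one_def]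

theorem twistLevel_single (N : OpenNormalSubgroup G) (g : G) (r : ℤ_[p]) :
    twistLevel ψ N (MonoidAlgebra.single (g : G ⧸ (infKer ψ N).toSubgroup) r) =
      MonoidAlgebra.single (g : G ⧸ N.toSubgroup) (r * ψ.toHom g) := by
  rw [twistLevel, MonoidAlgebra.lift_single, QuotientGroup.lift_mk, ← smul_eq_mul,
    ← MonoidAlgebra.smul_single]
  rfl

/-- The twisting homomorphism `Λ(G) → Λ(G)`, `g ↦ ψ(g) g`. -/
def twistHom : IwasawaAlgebra p G →ₐ[ℤ_[p]] IwasawaAlgebra p G :=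
  liftProj (fun N => (twistLevel ψ N).comp (proj p (infKer ψ N))) fun N N' h a => by
    have h' : (infKer ψ N).toSubgroup ≤ (infKer ψ N').toSubgroup := fun x hx => ⟨h hx.1, hx.2⟩
    rw [AlgHom.comp_apply, AlgHom.comp_apply, ← transition_proj h' a]
    generalize proj p (infKer ψ N) a = b
    induction b using MonoidAlgebra.induction_linear with
    | zero => simp
    | add x y hx hy => simp only [map_add, hx, hy]
    | single x r =>
      induction x using QuotientGroup.induction_on with | _ g
      rw [twistLevel_single]
      simp only [transition, MonoidAlgebra.mapDomainAlgHom_apply, MonoidAlgebra.mapDomain_single]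
      exact (twistLevel_single ψ N' g r).symm

theorem twistHom_of (g : G) : twistHom ψ (of p g) = (ψ.toHom g : ℤ_[p]) • of p g :=
  ext_proj fun N => by
    rw [twistHom, proj_liftProj, AlgHom.comp_apply, proj_of, map_smul, proj_of,
      MonoidAlgebra.of_apply, twistLevel_single, one_mul, MonoidAlgebra.of_apply,
      MonoidAlgebra.smul_single, smul_eq_mul, mul_one]

variable (M : Type v) [AddCommGroup M] [Module ℤ_[p] M]

/-- The tensor product `M ⊗_{ℤ_p} ℤ_p(ψ)`, where `ℤ_p(ψ)` is `ℤ_p` with `G` acting through `ψ`. -/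
def Twist (_ψ : OpenChar p G) (M : Type v) [AddCommGroup M] [Module ℤ_[p] M] : Type v :=
  M ⊗[ℤ_[p]] ℤ_[p]

instance : AddCommGroup (Twist ψ M) := inferInstanceAs (AddCommGroup (M ⊗[ℤ_[p]] ℤ_[p]))

/-- The element `m ⊗ a` of `M ⊗_{ℤ_p} ℤ_p(ψ)`. -/
def Twist.tmul (m : M) (a : ℤ_[p]) : Twist ψ M := m ⊗ₜ[ℤ_[p]] a

variable [Module (IwasawaAlgebra p G) M] [IsScalarTower ℤ_[p] (IwasawaAlgebra p G) M]

/-- `Λ(G)` acts on `M ⊗ ℤ_p(ψ)` by the extension of the diagonal action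
`g (m ⊗ a) = g m ⊗ ψ(g) a` of `G`, see `of_smul_tmul`. -/
instance : Module (IwasawaAlgebra p G) (Twist ψ M) where
  smul x t := LinearMap.rTensor ℤ_[p] (Algebra.lsmul ℤ_[p] ℤ_[p] M (twistHom ψ x)) t
  one_smul t := by
    change LinearMap.rTensor ℤ_[p] (Algebra.lsmul ℤ_[p] ℤ_[p] M (twistHom ψ 1)) t = t
    rw [map_one, map_one]
    exact LinearMap.rTensor_id_apply ℤ_[p] M t
  mul_smul x y t := by
    change LinearMap.rTensor ℤ_[p] (Algebra.lsmul ℤ_[p] ℤ_[p] M (twistHom ψ (x * y))) t =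
      LinearMap.rTensor ℤ_[p] (Algebra.lsmul ℤ_[p] ℤ_[p] M (twistHom ψ x))
        (LinearMap.rTensor ℤ_[p] (Algebra.lsmul ℤ_[p] ℤ_[p] M (twistHom ψ y)) t)
    rw [map_mul, map_mul]
    exact LinearMap.rTensor_comp_apply ℤ_[p] _ _ t
  smul_zero x := map_zero (LinearMap.rTensor ℤ_[p] _)
  smul_add x := map_add (LinearMap.rTensor ℤ_[p] _)
  add_smul x y t := by
    change LinearMap.rTensor ℤ_[p] (Algebra.lsmul ℤ_[p] ℤ_[p] M (twistHom ψ (x + y))) t =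
      LinearMap.rTensor ℤ_[p] (Algebra.lsmul ℤ_[p] ℤ_[p] M (twistHom ψ x)) t +
        LinearMap.rTensor ℤ_[p] (Algebra.lsmul ℤ_[p] ℤ_[p] M (twistHom ψ y)) t
    rw [map_add, map_add, LinearMap.rTensor_add]
    rfl
  zero_smul t := by
    change LinearMap.rTensor ℤ_[p] (Algebra.lsmul ℤ_[p] ℤ_[p] M (twistHom ψ 0)) t = 0
    rw [map_zero, map_zero, LinearMap.rTensor_zero]
    rfl

theorem of_smul_tmul (g : G) (m : M) (a : ℤ_[p]) :
    of p g • Twist.tmul ψ M m a = Twist.tmul ψ M (of p g • m) (ψ.toHom g * a) := by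
  change LinearMap.rTensor ℤ_[p] (Algebra.lsmul ℤ_[p] ℤ_[p] M (twistHom ψ (of p g)))
    (m ⊗ₜ[ℤ_[p]] a) = _
  rw [twistHom_of, LinearMap.rTensor_tmul]
  change (((ψ.toHom g : ℤ_[p]) • of p g) • m) ⊗ₜ[ℤ_[p]] a = _
  rw [smul_assoc, TensorProduct.smul_tmul]
  rfl

end Twist

section Comm

variable (p : ℕ) [Fact p.Prime] (G : Type u) [Group G] [TopologicalSpace G] [IsMulCommutative G]

instance : CommRing (IwasawaAlgebra p G) :=
  { (inferInstance : Ring (IwasawaAlgebra p G)) with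
    mul_comm := fun x y => ext_proj fun N => by
      rw [map_mul, map_mul]
      generalize proj p N x = a, proj p N y = b
      induction a using MonoidAlgebra.induction_linear with
      | zero => simp
      | add x y hx hy => rw [add_mul, mul_add, hx, hy]
      | single g r =>
        induction b using MonoidAlgebra.induction_linear with
        | zero => simp
        | add x y hx hy => rw [add_mul, mul_add, hx, hy]
        | single h s =>
          induction g using QuotientGroup.induction_on with | _ g
          induction h using QuotientGroup.induction_on with | _ h
          rw [MonoidAlgebra.single_mul_single, MonoidAlgebra.single_mul_single, mul_comm r s,
            ← QuotientGroup.mk_mul, ← QuotientGroup.mk_mul, mul_comm' g h] }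

/-- The `Λ(G)`-rank of a module `N`, for `Λ(G)` a commutative domain: the dimension of `K ⊗ N`
over the field of fractions `K` of `Λ(G)`. -/
def lambdaRank (N : Type v) [AddCommGroup N] [Module (IwasawaAlgebra p G) N] : ℕ :=
  Module.finrank (FractionRing (IwasawaAlgebra p G))
    (FractionRing (IwasawaAlgebra p G) ⊗[IwasawaAlgebra p G] N)

end Comm

section Decomposition

variable (p : ℕ) [Fact p.Prime] (G : Type u) [CommGroup G] [TopologicalSpace G]

/-- `Λ(Γ) → Λ(G)` for a subgroup `Γ` of a commutative group `G`. -/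
instance (Γ : Subgroup G) : Algebra (IwasawaAlgebra p Γ) (IwasawaAlgebra p G) :=
  (map p ⟨Γ.subtype, continuous_subtype_val⟩ :
    IwasawaAlgebra p Γ →ₐ[ℤ_[p]] IwasawaAlgebra p G).toRingHom.toAlgebra

variable {p G} {Γ Δ : Subgroup G}

/-- The character `G = Γ × Δ → Δ → ℤ_p^×` obtained from a character of `Δ`, for `Γ` open. -/
def inflate (hc : Δ.IsComplement' Γ) (ho : IsOpen (Γ : Set G)) (χ : Δ →* ℤ_[p]ˣ) [ContinuousMul G] :
    OpenChar p G where
  toHom := χ.comp (hc.QuotientMulEquiv.toMonoidHom.comp (QuotientGroup.mk' Γ))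
  isOpen_ker := by
    refine Subgroup.isOpen_mono (H₁ := Γ) (fun g hg => ?_) ho
    rw [MonoidHom.mem_ker, MonoidHom.comp_apply, MonoidHom.comp_apply, QuotientGroup.mk'_apply,
      (QuotientGroup.eq_one_iff g).2 hg, map_one, map_one]

theorem inflate_apply [ContinuousMul G] (hc : Δ.IsComplement' Γ) (ho : IsOpen (Γ : Set G))
    (χ : Δ →* ℤ_[p]ˣ) (γ : Γ) (δ : Δ) : (inflate hc ho χ).toHom (γ * δ) = χ δ := by
  have h : ((γ * δ : G) : G ⧸ Γ) = hc.QuotientMulEquiv.symm δ := by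
    rw [mul_comm]
    exact QuotientGroup.mk_mul_of_mem _ γ.2
  simp [inflate, h]

/-- The `χ`-eigenspace of `M`, on which `Δ` acts through `χ`; it is a `Λ(G)`-submodule. -/
def eigenspace (χ : Δ →* ℤ_[p]ˣ) (M : Type v) [AddCommGroup M] [Module ℤ_[p] M]
    [Module (IwasawaAlgebra p G) M] [IsScalarTower ℤ_[p] (IwasawaAlgebra p G) M] :
    Submodule (IwasawaAlgebra p G) M where
  carrier := {m | ∀ δ : Δ, of p (δ : G) • m = (χ δ : ℤ_[p]) • m}
  zero_mem' δ := by rw [smul_zero, smul_zero]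
  add_mem' ha hb δ := by rw [smul_add, smul_add, ha δ, hb δ]
  smul_mem' x m hm δ := by
    rw [smul_smul, mul_comm, mul_smul, hm δ, smul_algebra_smul_comm]

end Decomposition

end

end Iwasawa

/-! Since `|Δ| = p - 1` is a unit of `ℤ_p`, the idempotent `e = |Δ|⁻¹ ∑ δ` exists in `Λ(G)`. Let `t
= γ - 1` for a topological generator `γ` of `Γ`. The element `s = te + (1 - e)`, called `koszul`, is
a nonzerodivisor and generates `I(G)` (`isRegular_koszul`, `augmentationIdeal_eq_span_koszul`).
Hence for every `Λ(G)`-module `N` one has `H₀ = N / sN`, `H₁ = N[s]`, and `Hᵢ = 0` for `i ≥ 2`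
(`homology_zero`, `homology_one`, `homology_add_two`).

On the twist of `M`, the ring `Λ(G)` acts through `g ↦ χ(g) g`, which carries `e` to the projector
of `M` onto `W = M^{χ⁻¹}` and fixes `t`. So `s` acts as `t` on `W` and as the identity on the
complement, and its kernel and cokernel are those of `t` on `W` (`ker_twist`, `coker_twist`).

It remains to see that `rank_{ℤ_p} W/tW - rank_{ℤ_p} W[t] = rank_{Λ(Γ)} W`
(`IsResidueRing.finrank_coker`). Both sides are additive in short exact sequences, so dévissage
reduces to `W = Λ(Γ)/P` with `P` prime. This uses that `Λ(Γ)` is a Noetherian domain with `Λ(Γ)/t =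
ℤ_p`, a consequence of `Λ(Γ) ≅ ℤ_p⟦T⟧`, `t ↔ T` (`exists_powerSeries_equiv`). That isomorphism is
built level by level with Weierstrass division; it is injective by Krull's intersection theorem and
surjective by compactness. -/

namespace Iwasawa

noncomputable section

/-! ### Homology of `K / sK` for a regular element `s`. -/

section QuotientFunctor

variable {R : Type u} [CommRing R]

/-- The functor `N ↦ N / IN` on modules over a commutative ring. -/
def quotientFunctor (I : Ideal R) : ModuleCat.{v} R ⥤ ModuleCat.{v} R where
  obj M := ModuleCat.of R (M ⧸ (I • ⊤ : Submodule R M))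
  map f := ModuleCat.ofHom (Submodule.mapQ _ _ f.hom (by
      rw [← Submodule.map_le_iff_le_comap, Submodule.map_smul'']
      exact smul_mono_right _ le_top))
  map_id M := by
    ext x
    rfl
  map_comp f g := by
    ext x
    rfl

instance (I : Ideal R) : (quotientFunctor.{u, v} I).Additive where
  map_add {M N f g} := by
    ext x
    obtain ⟨x, rfl⟩ := Submodule.Quotient.mk_surjective _ x
    rfl

/-- The projection `N → N / IN`, as a natural transformation. -/
def quotientProjection (I : Ideal R) : 𝟭 (ModuleCat.{v} R) ⟶ quotientFunctor I where
  app M := ModuleCat.ofHom (Submodule.mkQ _)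

variable (K : ChainComplex (ModuleCat.{v} R) ℕ) (s : R)

/-- The projection of complexes `K → K / IK`. -/
def complexProjection (I : Ideal R) :
    K ⟶ ((quotientFunctor I).mapHomologicalComplex _).obj K where
  f n := (quotientProjection I).app (K.X n)
  comm' _ _ _ := ((quotientProjection I).naturality _).symm

/-- The sequence of complexes `0 → K → K → K / sK → 0`. -/
def smulShortComplex : ShortComplex (ChainComplex (ModuleCat.{v} R) ℕ) where
  f := s • 𝟙 K
  g := complexProjection K (Ideal.span {s})
  zero := by
    ext n x
    change Submodule.Quotient.mk (s • x) = 0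
    rw [Submodule.Quotient.mk_eq_zero]
    exact Submodule.smul_mem_smul (Ideal.mem_span_singleton_self s) trivial

variable {K s}

theorem smulShortComplex_shortExact (h : ∀ n, IsSMulRegular (K.X n) s) :
    (smulShortComplex K s).ShortExact := by
  refine HomologicalComplex.shortExact_of_degreewise_shortExact _ fun n => ?_
  refine ModuleCat.shortComplex_shortExact _ (fun x => ?_) (h n) (Submodule.mkQ_surjective _)
  let x : K.X n := x
  change Submodule.Quotient.mk (p := Ideal.span {s} • (⊤ : Submodule R (K.X n))) x = 0 ↔
    ∃ y : K.X n, s • y = x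
  rw [Submodule.Quotient.mk_eq_zero, Submodule.ideal_span_singleton_smul]
  simp [Submodule.mem_smul_pointwise_iff_exists]

theorem homologyMap_smul_id (n : ℕ) :
    HomologicalComplex.homologyMap (s • 𝟙 K) n = s • 𝟙 (K.homology n) := by
  have : (HomologicalComplex.shortComplexFunctor _ _ n).map (s • 𝟙 K) =
    s • 𝟙 (K.sc n) := by ext <;> rfl
  rw [HomologicalComplex.homologyMap, this, ShortComplex.homologyMap_smul,
    ShortComplex.homologyMap_id]
  rfl

theorem exact_smul_homologyMap (h : ∀ n, IsSMulRegular (K.X n) s) (x : K.homology 0) :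
    (HomologicalComplex.homologyMap (complexProjection K (Ideal.span {s})) 0).hom x = 0 ↔
      ∃ y, s • y = x := by
  have h2 := (ShortComplex.ShortExact.moduleCat_exact_iff_function_exact _).1
    ((smulShortComplex_shortExact h).homology_exact₂ 0) x
  refine h2.trans (exists_congr fun y => ?_)
  change (HomologicalComplex.homologyMap (s • 𝟙 K) 0).hom y = x ↔ _
  rw [homologyMap_smul_id]
  rfl

/-- If `H₀(K) = N` then the homology of `K / sK` in degree `0` is `N / sN`. -/
theorem homology_zero_quotient (h : ∀ n, IsSMulRegular (K.X n) s) {N : Type v} [AddCommGroup N]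
    [Module R N] (e : N ≃ₗ[R] K.homology 0) :
    Nonempty ((((quotientFunctor (Ideal.span {s})).mapHomologicalComplex _).obj K).homology 0 ≃ₗ[R]
      N ⧸ LinearMap.range (LinearMap.lsmul R N s)) := by
  let g : K.homology 0 →ₗ[R]
      (((quotientFunctor (Ideal.span {s})).mapHomologicalComplex _).obj K).homology 0 :=
    (HomologicalComplex.homologyMap (complexProjection K (Ideal.span {s})) 0).hom
  have h1 : Function.Surjective g := by
    refine (ModuleCat.epi_iff_surjective _).1 ?_
    have := (smulShortComplex_shortExact h).epi_g
    -- Degree `0` is the bottom of the complexes, so `H₀` preserves the surjection.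
    exact HomologicalComplex.epi_homologyMap_of_epi_of_not_rel (smulShortComplex K s).g 0 (by simp)
  have h3 : LinearMap.range (LinearMap.lsmul R N s) = LinearMap.ker (g ∘ₗ e.toLinearMap) := by
    ext x
    refine Iff.trans ⟨?_, ?_⟩ (exact_smul_homologyMap h (e x)).symm
    · rintro ⟨y, rfl⟩
      exact ⟨e y, (map_smul e s y).symm⟩
    · rintro ⟨y, hy⟩
      exact ⟨e.symm y, e.injective ((map_smul e s _).trans (by rw [e.apply_symm_apply, hy]))⟩
  exact ⟨((Submodule.quotEquivOfEq _ _ h3).trans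
    ((g ∘ₗ e.toLinearMap).quotKerEquivOfSurjective (h1.comp e.surjective))).symm⟩

/-- If `H₁(K) = 0` and `H₀(K) = N` then the homology of `K / sK` in degree `1` is `N[s]`. -/
theorem homology_one_quotient (h : ∀ n, IsSMulRegular (K.X n) s) (h1 : K.ExactAt 1)
    {N : Type v} [AddCommGroup N] [Module R N] (e : N ≃ₗ[R] K.homology 0) :
    Nonempty ((((quotientFunctor (Ideal.span {s})).mapHomologicalComplex _).obj K).homology 1 ≃ₗ[R]
      LinearMap.ker (LinearMap.lsmul R N s)) := by
  have hS := smulShortComplex_shortExact h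
  -- As `H₁(K) = 0`, the connecting map `H₁(K/sK) → H₀(K)` is injective; its image is the kernel of
  -- `s`.
  have : Mono (hS.δ 1 0 rfl) := hS.mono_δ 1 0 rfl h1.isZero_homology
  let d : (((quotientFunctor (Ideal.span {s})).mapHomologicalComplex _).obj K).homology 1 →ₗ[R]
      K.homology 0 := (hS.δ 1 0 rfl).hom
  have hi : Function.Injective d := (ModuleCat.mono_iff_injective _).1 this
  have h2 (x : K.homology 0) : s • x = 0 ↔ ∃ y, d y = x := by
    refine Iff.trans ?_ ((ShortComplex.ShortExact.moduleCat_exact_iff_function_exact _).1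
      (hS.homology_exact₁ 1 0 rfl) x)
    change _ ↔ (HomologicalComplex.homologyMap (s • 𝟙 K) 0).hom x = 0
    rw [homologyMap_smul_id]
    rfl
  have h3 : LinearMap.range (e.symm.toLinearMap ∘ₗ d) = LinearMap.ker (LinearMap.lsmul R N s) := by
    ext x
    have h4 : s • x = 0 ↔ s • e x = 0 := by rw [← map_smul, e.map_eq_zero_iff]
    refine Iff.trans ?_ (h4.trans (h2 (e x))).symm
    exact exists_congr fun y => e.symm_apply_eq
  exact ⟨(LinearEquiv.ofInjective (e.symm.toLinearMap ∘ₗ d) (e.symm.injective.comp hi)).trans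
    (LinearEquiv.ofEq _ _ h3)⟩

/-- The long exact sequence places this group between `H_{i+2}(K)` and `H_{i+1}(K)`, which both
vanish. -/
theorem isZero_homology_quotient (h : ∀ n, IsSMulRegular (K.X n) s) (i : ℕ)
    (h1 : K.ExactAt (i + 1)) (h2 : K.ExactAt (i + 2)) :
    Limits.IsZero
      ((((quotientFunctor (Ideal.span {s})).mapHomologicalComplex _).obj K).homology (i + 2)) := by
  have hS := smulShortComplex_shortExact h
  exact h1.isZero_homology.of_iso
    (hS.δIso (i + 2) (i + 1) rfl h2.isZero_homology h1.isZero_homology)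

theorem restrictScalars_linearEquiv {p : ℕ} [Fact p.Prime] {R : Type u} [Ring R] [Algebra ℤ_[p] R]
    {N : Type v}
    [AddCommGroup N] [Module R N] [Module ℤ_[p] N] [IsScalarTower ℤ_[p] R N]
    {H : ModuleCat.{v} R} (e : H ≃ₗ[R] N) :
    Nonempty ((ModuleCat.restrictScalars (algebraMap ℤ_[p] R)).obj H ≃ₗ[ℤ_[p]] N) :=
  ⟨{ e with map_smul' := fun r x => (map_smul e (algebraMap ℤ_[p] _ r) x).trans
              (algebraMap_smul _ r (e x)) }⟩

/-- Projective modules are flat, and a nonzerodivisor acts injectively on a flat module. -/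
theorem resolution_isSMulRegular {R : Type u} [CommRing R] [Small.{v} R] {N : ModuleCat.{v} R}
    (P : ProjectiveResolution N) {s : R} (hs : IsRegular s) (n : ℕ) :
    IsSMulRegular (P.complex.X n) s := by
  have := (IsProjective.iff_projective (R := R) (P.complex.X n)).2 (P.projective n)
  exact Module.Flat.isSMulRegular_of_isRegular hs

/-- The homology in degree `0` of a projective resolution. -/
def resolutionHomologyIso {R : Type u} [CommRing R] {N : ModuleCat.{v} R}
    (P : ProjectiveResolution N) : P.complex.homology 0 ≅ N :=
  isoOfQuasiIsoAt P.π 0 ≪≫ HomologicalComplex.singleObjHomologySelfIso _ _ _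

end QuotientFunctor

/-! ### Group homology when `I(G)` is generated by a regular element. -/

section Homology

variable {p : ℕ} [Fact p.Prime] {G : Type u} [Group G] [TopologicalSpace G] [IsMulCommutative G]
  [Small.{v} (IwasawaAlgebra p G)] (N : Type v) [AddCommGroup N] [Module (IwasawaAlgebra p G) N]

/-- Restriction of scalars to `ℤ_p` is exact, so it commutes with homology and the whole computation
can be done over `Λ(G)`. -/
theorem homology_iso (P : ProjectiveResolution (ModuleCat.of (IwasawaAlgebra p G) N)) (i : ℕ) :
    Nonempty (homology p G N i ≅
      (ModuleCat.restrictScalars (algebraMap ℤ_[p] (IwasawaAlgebra p G))).obj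
        ((((quotientFunctor (augmentationIdeal p G)).mapHomologicalComplex _).obj
          P.complex).homology i)) :=
  ⟨P.isoLeftDerivedObj (coinvariants p G) i ≪≫
    ((((quotientFunctor (augmentationIdeal p G)).mapHomologicalComplex _).obj
          P.complex).sc i).mapHomologyIso
          (ModuleCat.restrictScalars (algebraMap ℤ_[p] (IwasawaAlgebra p G)))⟩

variable {N}

theorem homology_zero [Module ℤ_[p] N] [IsScalarTower ℤ_[p] (IwasawaAlgebra p G) N]
    {s : IwasawaAlgebra p G} (hs : IsRegular s) (hI : augmentationIdeal p G = Ideal.span {s}) :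
    Nonempty (homology p G N 0 ≃ₗ[ℤ_[p]]
      N ⧸ LinearMap.range (LinearMap.lsmul (IwasawaAlgebra p G) N s)) := by
  let P := projectiveResolution (ModuleCat.of (IwasawaAlgebra p G) N)
  obtain ⟨f⟩ := homology_iso N P 0
  rw [hI] at f
  obtain ⟨g⟩ := homology_zero_quotient (N := N) (resolution_isSMulRegular P hs)
    (resolutionHomologyIso P).symm.toLinearEquiv
  obtain ⟨h⟩ := restrictScalars_linearEquiv (p := p) g
  exact ⟨f.toLinearEquiv.trans h⟩

theorem homology_one [Module ℤ_[p] N] [IsScalarTower ℤ_[p] (IwasawaAlgebra p G) N]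
    {s : IwasawaAlgebra p G} (hs : IsRegular s) (hI : augmentationIdeal p G = Ideal.span {s}) :
    Nonempty (homology p G N 1 ≃ₗ[ℤ_[p]]
      LinearMap.ker (LinearMap.lsmul (IwasawaAlgebra p G) N s)) := by
  let P := projectiveResolution (ModuleCat.of (IwasawaAlgebra p G) N)
  obtain ⟨f⟩ := homology_iso N P 1
  rw [hI] at f
  obtain ⟨g⟩ := homology_one_quotient (N := N) (resolution_isSMulRegular P hs)
    (P.complex_exactAt_succ 0)
    (resolutionHomologyIso P).symm.toLinearEquiv
  obtain ⟨h⟩ := restrictScalars_linearEquiv (p := p) g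
  exact ⟨f.toLinearEquiv.trans h⟩

theorem homology_add_two {s : IwasawaAlgebra p G} (hs : IsRegular s)
    (hI : augmentationIdeal p G = Ideal.span {s}) (i : ℕ) :
    Subsingleton (homology p G N (i + 2)) := by
  let P := projectiveResolution (ModuleCat.of (IwasawaAlgebra p G) N)
  obtain ⟨f⟩ := homology_iso N P (i + 2)
  rw [hI] at f
  exact ModuleCat.subsingleton_of_isZero <| (Functor.map_isZero _ (isZero_homology_quotient
    (resolution_isSMulRegular P hs) i (P.complex_exactAt_succ i)
      (P.complex_exactAt_succ (i + 1)))).of_iso f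

end Homology

/-! ### Additivity of ranks over a domain. -/

section Rank

variable {O : Type*} [CommRing O]

theorem finrank_eq_zero_of_torsion {V : Type*} [AddCommGroup V] [Module O V]
    (h : ∀ x : V, ∃ a : O, a ≠ 0 ∧ a • x = 0) : Module.finrank O V = 0 := by
  rw [Module.finrank, rank_eq_zero_iff.2 h, map_zero]

variable [IsDomain O]

theorem finrank_range_add_finrank_ker {V W : Type*} [AddCommGroup V] [Module O V]
    [AddCommGroup W] [Module O W] [Module.Finite O V] (f : V →ₗ[O] W) :
    Module.finrank O (LinearMap.range f) + Module.finrank O (LinearMap.ker f) =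
      Module.finrank O V := by
  rw [← f.quotKerEquivRange.finrank_eq]
  exact Submodule.finrank_quotient_add_finrank _

open Module in
/-- The Euler characteristic of an exact sequence with six terms over a domain. -/
theorem finrank_exact_six {V₀ V₁ V₂ V₃ V₄ V₅ : Type*}
    [AddCommGroup V₀] [Module O V₀] [Module.Finite O V₀]
    [AddCommGroup V₁] [Module O V₁] [Module.Finite O V₁]
    [AddCommGroup V₂] [Module O V₂] [Module.Finite O V₂]
    [AddCommGroup V₃] [Module O V₃] [Module.Finite O V₃]
    [AddCommGroup V₄] [Module O V₄] [Module.Finite O V₄]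
    [AddCommGroup V₅] [Module O V₅]
    {f₀ : V₀ →ₗ[O] V₁} {f₁ : V₁ →ₗ[O] V₂} {f₂ : V₂ →ₗ[O] V₃} {f₃ : V₃ →ₗ[O] V₄} {f₄ : V₄ →ₗ[O] V₅}
    (inj : Function.Injective f₀) (h₁ : Function.Exact f₀ f₁) (h₂ : Function.Exact f₁ f₂)
    (h₃ : Function.Exact f₂ f₃) (h₄ : Function.Exact f₃ f₄) (surj : Function.Surjective f₄) :
    finrank O V₀ + finrank O V₂ + finrank O V₄ = finrank O V₁ + finrank O V₃ + finrank O V₅ := by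
  have e₀ := LinearMap.finrank_range_of_inj inj
  have e₁ := finrank_range_add_finrank_ker f₁
  have e₂ := finrank_range_add_finrank_ker f₂
  have e₃ := finrank_range_add_finrank_ker f₃
  have e₄ := finrank_range_add_finrank_ker f₄
  rw [h₁.linearMap_ker_eq] at e₁
  rw [h₂.linearMap_ker_eq] at e₂
  rw [h₃.linearMap_ker_eq] at e₃
  rw [h₄.linearMap_ker_eq, LinearMap.range_eq_top.2 surj, finrank_top] at e₄
  omega

theorem finrank_exact_three {V₁ V₂ V₃ : Type*} [AddCommGroup V₁] [Module O V₁]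
    [AddCommGroup V₂] [Module O V₂] [AddCommGroup V₃] [Module O V₃] [Module.Finite O V₂]
    {f : V₁ →ₗ[O] V₂} {g : V₂ →ₗ[O] V₃} (hf : Function.Injective f) (hg : Function.Surjective g)
    (h : Function.Exact f g) :
    Module.finrank O V₂ = Module.finrank O V₁ + Module.finrank O V₃ := by
  have e := finrank_range_add_finrank_ker g
  rw [h.linearMap_ker_eq, LinearMap.range_eq_top.2 hg, finrank_top,
    LinearMap.finrank_range_of_inj hf] at e
  omega

end Rank

/-! ### The rank formula over a Noetherian domain `A` with `A / t = O`. -/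

section ResidueRing

variable {O : Type*} [CommRing O] {A : Type u} [CommRing A] [Algebra O A] {t : A}

/-- `O` is a set of representatives of the residue classes of `A` modulo `t`. -/
structure IsResidueRing (O : Type*) [CommRing O] {A : Type u} [CommRing A] [Algebra O A] (t : A) :
    Prop where
  exists_eq (a : A) : ∃ (r : O) (b : A), a = algebraMap O A r + t * b
  eq_zero (r : O) : t ∣ algebraMap O A r → r = 0

variable {N : Type v} [AddCommGroup N] [Module A N] [Module O N] [IsScalarTower O A N]

/-- Because `A = O + tA` and `t` kills `N`, the `O`-span of a set of `A`-generators is already an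
`A`-submodule. -/
theorem IsResidueRing.finite (ht : IsResidueRing O t) [Module.Finite A N]
    (hN : ∀ x : N, t • x = 0) : Module.Finite O N := by
  obtain ⟨S, hS⟩ := Module.Finite.fg_top (R := A) (M := N)
  refine ⟨S, Submodule.eq_top_iff'.2 fun x => ?_⟩
  have hx : x ∈ Submodule.span A (S : Set N) := hS ▸ trivial
  induction hx using Submodule.span_induction with
  | mem x h => exact Submodule.subset_span h
  | zero => exact zero_mem _
  | add x y _ _ hx hy => exact add_mem hx hy
  | smul a x _ hx =>
    obtain ⟨r, b, rfl⟩ := ht.exists_eq a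
    rw [add_smul, mul_comm, mul_smul, hN, smul_zero, add_zero, algebraMap_smul]
    exact Submodule.smul_mem _ r hx

theorem IsResidueRing.finite_coker (ht : IsResidueRing O t) [Module.Finite A N] :
    Module.Finite O (N ⧸ LinearMap.range (LinearMap.lsmul A N t)) := by
  refine ht.finite fun x => ?_
  obtain ⟨x, rfl⟩ := Submodule.Quotient.mk_surjective _ x
  exact (Submodule.Quotient.mk_eq_zero _).2 ⟨x, rfl⟩

theorem IsResidueRing.finite_ker (ht : IsResidueRing O t) [IsNoetherianRing A]
    [Module.Finite A N] : Module.Finite O (LinearMap.ker (LinearMap.lsmul A N t)) :=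
  ht.finite fun x => Subtype.ext x.2

variable [IsDomain O]

/-- Divide a nonzero element of `P` by the highest power of `t` in it. The quotient stays in `P` as
`t ∉ P`, and its residue `r` is nonzero. So `P` has nonzero image in `A / t = O`. -/
theorem IsResidueRing.exists_mem (ht : IsResidueRing O t) [IsNoetherianRing A] [IsDomain A]
    {P : Ideal A} [P.IsPrime] (h0 : P ≠ ⊥) (h1 : t ∉ P) :
    ∃ (r : O) (b : A), r ≠ 0 ∧ algebraMap O A r + t * b ∈ P := by
  obtain ⟨f, hf, hf0⟩ := Submodule.exists_mem_ne_zero_of_ne_bot h0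
  have hu : ¬ IsUnit t := fun hu => one_ne_zero (ht.eq_zero 1 (hu.dvd))
  obtain ⟨g, hfg, hg⟩ := (FiniteMultiplicity.of_not_isUnit hu hf0).exists_eq_pow_mul_and_not_dvd
  rw [hfg] at hf
  obtain ⟨r, b, rfl⟩ := ht.exists_eq g
  refine ⟨r, b, ?_, (Ideal.IsPrime.mem_or_mem ‹_› hf).resolve_left
    fun h => h1 (Ideal.IsPrime.mem_of_pow_mem ‹_› _ h)⟩
  rintro rfl
  exact hg (by simp)

/-- If `P = 0`, the cokernel is `A / t = O`, the kernel is `0`, and both sides are `1`. If `P ≠ 0`,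
the `A`-rank is `0`: for `t ∈ P` kernel and cokernel are both `N`, and for `t ∉ P` the kernel is `0`
and the cokernel is `O`-torsion by `IsResidueRing.exists_mem`. -/
theorem IsResidueRing.finrank_coker_quotient (ht : IsResidueRing O t) (ht0 : t ≠ 0)
    [IsNoetherianRing A]
    [IsDomain A] (P : Ideal A) [P.IsPrime] [Module.Finite A N] (e : N ≃ₗ[A] A ⧸ P) :
    Module.finrank O (N ⧸ LinearMap.range (LinearMap.lsmul A N t)) =
      Module.finrank O (LinearMap.ker (LinearMap.lsmul A N t)) + Module.finrank A N := by
  have hr : ∀ a ∈ P, ∀ x : N, a • x = 0 := fun a ha x => e.injective <| by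
    obtain ⟨b, hb⟩ := Ideal.Quotient.mk_surjective (e x)
    rw [map_smul, map_zero, ← hb, ← Ideal.Quotient.mk_eq_mk, ← Submodule.Quotient.mk_smul,
      Submodule.Quotient.mk_eq_zero]
    exact P.mul_mem_right b ha
  have inj (h1 : t ∉ P) : LinearMap.ker (LinearMap.lsmul A N t) = ⊥ := by
    rw [LinearMap.ker_eq_bot']
    intro x hx
    obtain ⟨b, hb⟩ := Ideal.Quotient.mk_surjective (e x)
    have h2 : e (t • x) = 0 := e.map_eq_zero_iff.2 hx
    rw [map_smul, ← hb, ← Ideal.Quotient.mk_eq_mk, ← Submodule.Quotient.mk_smul,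
      Submodule.Quotient.mk_eq_zero] at h2
    rw [← e.map_eq_zero_iff, ← hb, Ideal.Quotient.eq_zero_iff_mem]
    exact (Ideal.IsPrime.mem_or_mem ‹_› h2).resolve_left h1
  by_cases h0 : P = ⊥
  · subst h0
    let e' : N ≃ₗ[A] A := e.trans (Submodule.quotEquivOfEqBot _ rfl)
    let q := LinearMap.toSpanSingleton O (N ⧸ LinearMap.range (LinearMap.lsmul A N t))
      (Submodule.Quotient.mk (e'.symm 1))
    have hq (r : O) : q r = Submodule.Quotient.mk (e'.symm (algebraMap O A r)) := by
      change Submodule.Quotient.mk (r • e'.symm 1) = _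
      rw [← algebraMap_smul A, ← map_smul, smul_eq_mul, mul_one]
    have hb : Function.Bijective q := by
      constructor
      · refine (injective_iff_map_eq_zero _).2 fun r h => ?_
        rw [hq, Submodule.Quotient.mk_eq_zero] at h
        obtain ⟨y, hy⟩ := h
        refine ht.eq_zero r ⟨e' y, ?_⟩
        rw [← smul_eq_mul, ← map_smul, ← e'.apply_symm_apply (algebraMap O A r), ← hy]
        rfl
      · intro x
        obtain ⟨x, rfl⟩ := Submodule.Quotient.mk_surjective _ x
        obtain ⟨r, b, h⟩ := ht.exists_eq (e' x)
        refine ⟨r, ?_⟩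
        rw [hq, Submodule.Quotient.eq]
        refine ⟨-e'.symm b, e'.injective ?_⟩
        rw [LinearMap.lsmul_apply, smul_neg, map_neg, map_smul, map_sub, e'.apply_symm_apply,
          e'.apply_symm_apply, h, smul_eq_mul]
        ring
    rw [inj (by simpa using ht0), e'.finrank_eq, ← (LinearEquiv.ofBijective q hb).finrank_eq,
      Module.finrank_self, Module.finrank_self, finrank_eq_zero_of_torsion]
    exact fun x => ⟨1, one_ne_zero, Subsingleton.elim _ _⟩
  have hA : Module.finrank A N = 0 := by
    obtain ⟨a, ha, ha0⟩ := Submodule.exists_mem_ne_zero_of_ne_bot h0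
    exact finrank_eq_zero_of_torsion fun x => ⟨a, ha0, hr a ha x⟩
  rw [hA, add_zero]
  by_cases h1 : t ∈ P
  · have h2 : LinearMap.lsmul A N t = 0 := LinearMap.ext (hr t h1)
    rw [h2, LinearMap.range_zero, LinearMap.ker_zero]
    refine LinearEquiv.finrank_eq ?_
    exact (((Submodule.quotEquivOfEqBot (⊥ : Submodule A N) rfl).trans
      Submodule.topEquiv.symm).restrictScalars O)
  · rw [inj h1, finrank_eq_zero_of_torsion, finrank_eq_zero_of_torsion]
    · exact fun x => ⟨1, one_ne_zero, Subsingleton.elim _ _⟩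
    · intro x
      obtain ⟨x, rfl⟩ := Submodule.Quotient.mk_surjective _ x
      obtain ⟨r, b, hr0, hP⟩ := ht.exists_mem h0 h1
      refine ⟨r, hr0, (Submodule.Quotient.mk_eq_zero _).2 ⟨-(b • x), ?_⟩⟩
      have h3 := hr _ hP x
      rw [add_smul, algebraMap_smul, mul_smul] at h3
      rw [LinearMap.lsmul_apply, smul_neg, eq_comm, eq_neg_iff_add_eq_zero, h3]

/-- The snake lemma for multiplication by `t` gives a six-term exact sequence of finite `O`-modules;
its Euler characteristic is combined with the additivity of the `A`-rank. -/
theorem IsResidueRing.finrank_coker_exact (ht : IsResidueRing O t) [IsNoetherianRing A]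
    [IsDomain A] {N₁ N₂ N₃ : Type v} [AddCommGroup N₁] [Module A N₁] [Module O N₁]
    [IsScalarTower O A N₁] [AddCommGroup N₂] [Module A N₂] [Module O N₂]
    [IsScalarTower O A N₂] [AddCommGroup N₃] [Module A N₃] [Module O N₃]
    [IsScalarTower O A N₃] [Module.Finite A N₁] [Module.Finite A N₂] [Module.Finite A N₃]
    (f : N₁ →ₗ[A] N₂) (g : N₂ →ₗ[A] N₃) (hf : Function.Injective f)
    (hg : Function.Surjective g) (h : Function.Exact f g)
    (h₁ : Module.finrank O (N₁ ⧸ LinearMap.range (LinearMap.lsmul A N₁ t)) =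
      Module.finrank O (LinearMap.ker (LinearMap.lsmul A N₁ t)) + Module.finrank A N₁)
    (h₃ : Module.finrank O (N₃ ⧸ LinearMap.range (LinearMap.lsmul A N₃ t)) =
      Module.finrank O (LinearMap.ker (LinearMap.lsmul A N₃ t)) + Module.finrank A N₃) :
    Module.finrank O (N₂ ⧸ LinearMap.range (LinearMap.lsmul A N₂ t)) =
      Module.finrank O (LinearMap.ker (LinearMap.lsmul A N₂ t)) + Module.finrank A N₂ := by
  have := ht.finite_coker (N := N₁)
  have := ht.finite_coker (N := N₂)
  have := ht.finite_coker (N := N₃)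
  have := ht.finite_ker (N := N₁)
  have := ht.finite_ker (N := N₂)
  have := ht.finite_ker (N := N₃)
  let f' : LinearMap.ker (LinearMap.lsmul A N₁ t) →ₗ[A] LinearMap.ker (LinearMap.lsmul A N₂ t) :=
    f.restrict fun x hx => by
      change t • f x = 0
      rw [← map_smul, show t • x = 0 from hx, map_zero]
  let g' : LinearMap.ker (LinearMap.lsmul A N₂ t) →ₗ[A] LinearMap.ker (LinearMap.lsmul A N₃ t) :=
    g.restrict fun x hx => by
      change t • g x = 0
      rw [← map_smul, show t • x = 0 from hx, map_zero]
  let f'' : (N₁ ⧸ LinearMap.range (LinearMap.lsmul A N₁ t)) →ₗ[A]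
      N₂ ⧸ LinearMap.range (LinearMap.lsmul A N₂ t) :=
    Submodule.mapQ _ _ f <| by
      rintro _ ⟨x, rfl⟩
      exact ⟨f x, (map_smul f t x).symm⟩
  let g'' : (N₂ ⧸ LinearMap.range (LinearMap.lsmul A N₂ t)) →ₗ[A]
      N₃ ⧸ LinearMap.range (LinearMap.lsmul A N₃ t) :=
    Submodule.mapQ _ _ g <| by
      rintro _ ⟨x, rfl⟩
      exact ⟨g x, (map_smul g t x).symm⟩
  have hc₁ : f.comp (LinearMap.lsmul A N₁ t) = (LinearMap.lsmul A N₂ t).comp f :=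
    LinearMap.ext fun x => map_smul f t x
  have hc₂ : g.comp (LinearMap.lsmul A N₂ t) = (LinearMap.lsmul A N₃ t).comp g :=
    LinearMap.ext fun x => map_smul g t x
  let d := SnakeLemma.δ' (LinearMap.lsmul A N₁ t) (LinearMap.lsmul A N₂ t)
    (LinearMap.lsmul A N₃ t) f g h f g h hc₁ hc₂
    (LinearMap.ker (LinearMap.lsmul A N₃ t)).subtype (LinearMap.exact_subtype_ker_map _)
    (LinearMap.range (LinearMap.lsmul A N₁ t)).mkQ (LinearMap.exact_map_mkQ_range _) hg hf
  have e₂ : Function.Exact g' d :=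
    SnakeLemma.exact_δ'_right _ _ _ _ _ _ _ _ _ _ _ _ (LinearMap.exact_subtype_ker_map _) _ _ _ _
      hg hf g' rfl (Submodule.subtype_injective _)
  have e₃ : Function.Exact d f'' :=
    SnakeLemma.exact_δ'_left _ _ _ _ _ _ _ _ _ _ _ _ _ _ _ _ (LinearMap.exact_map_mkQ_range _)
      hg hf f'' rfl (Submodule.mkQ_surjective _)
  have e₁ : Function.Exact f' g' := by
    rintro ⟨x, hx⟩
    refine Iff.trans (Subtype.ext_iff.trans (h x)) ⟨?_, ?_⟩
    · rintro ⟨y, rfl⟩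
      exact ⟨⟨y, hf ((map_smul f t y).trans (hx.trans (map_zero f).symm))⟩, rfl⟩
    · rintro ⟨y, hy⟩
      exact ⟨y, congrArg Subtype.val hy⟩
  have e₄ : Function.Exact f'' g'' := by
    intro x
    obtain ⟨x, rfl⟩ := Submodule.Quotient.mk_surjective _ x
    refine Iff.trans (Submodule.Quotient.mk_eq_zero _) ⟨?_, ?_⟩
    · rintro ⟨y, hy⟩
      obtain ⟨y, rfl⟩ := hg y
      obtain ⟨z, hz⟩ := (h (x - t • y)).1 (by
        rw [map_sub, map_smul, sub_eq_zero]; exact hy.symm)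
      refine ⟨Submodule.Quotient.mk z, (Submodule.Quotient.eq _).2 ⟨-y, ?_⟩⟩
      change t • (-y) = f z - x
      rw [hz, smul_neg]
      abel
    · rintro ⟨y, hy⟩
      obtain ⟨y, rfl⟩ := Submodule.Quotient.mk_surjective _ y
      obtain ⟨z, hz⟩ := (Submodule.Quotient.eq _).1 hy
      refine ⟨g (-z), ?_⟩
      change t • g (-z) = g x
      have hz' : t • z = f y - x := hz
      rw [← map_smul, smul_neg, hz', neg_sub, map_sub, h.apply_apply_eq_zero, sub_zero]
  have six := finrank_exact_six (O := O) (f₀ := f'.restrictScalars O) (f₁ := g'.restrictScalars O)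
    (f₂ := d.restrictScalars O) (f₃ := f''.restrictScalars O) (f₄ := g''.restrictScalars O)
    (fun x y hxy => Subtype.ext (hf (congrArg Subtype.val hxy))) e₁ e₂ e₃ e₄ (by
      intro x
      obtain ⟨x, rfl⟩ := Submodule.Quotient.mk_surjective _ x
      obtain ⟨y, rfl⟩ := hg x
      exact ⟨Submodule.Quotient.mk y, rfl⟩)
  have := finrank_exact_three hf hg h
  omega

/-- For a finitely generated module `N` over a Noetherian domain `A` with `A / t = O`, the
`A`-rank of `N` is the difference of the `O`-ranks of `N / tN` and of `N[t]`. -/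
theorem IsResidueRing.finrank_coker (ht : IsResidueRing O t) (ht0 : t ≠ 0)
    [IsNoetherianRing A] [IsDomain A]
    [hN : Module.Finite A N] :
    Module.finrank O (N ⧸ LinearMap.range (LinearMap.lsmul A N t)) =
      Module.finrank O (LinearMap.ker (LinearMap.lsmul A N t)) + Module.finrank A N := by
  -- The `O`-structure is generalised first, because the induction principle ranges over bare
  -- `A`-modules.
  suffices ∀ [Module O N] [IsScalarTower O A N],
    Module.finrank O (N ⧸ LinearMap.range (LinearMap.lsmul A N t)) =
      Module.finrank O (LinearMap.ker (LinearMap.lsmul A N t)) + Module.finrank A N from this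
  induction hN using IsNoetherianRing.induction_on_isQuotientEquivQuotientPrime A with
  | subsingleton N =>
    intros
    simp [Module.finrank_zero_of_subsingleton]
  | quotient N p f =>
    intros
    have := p.2
    exact ht.finrank_coker_quotient ht0 p.1 f
  | exact N₁ N₂ N₃ f g hf hg hfg h₁ h₃ =>
    intros
    let _ : Module O N₁ := Module.compHom N₁ (algebraMap O A)
    let _ : Module O N₃ := Module.compHom N₃ (algebraMap O A)
    have : IsScalarTower O A N₁ := IsScalarTower.of_algebraMap_smul fun _ _ => rfl
    have : IsScalarTower O A N₃ := IsScalarTower.of_algebraMap_smul fun _ _ => rfl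
    exact ht.finrank_coker_exact f g hf hg hfg h₁ h₃

end ResidueRing

/-! ### Weierstrass division by `(1 + T) ^ p ^ n - 1` and evaluation of power series. -/

section Evaluation

variable (p : ℕ) [Fact p.Prime]

/-- The polynomial `(1 + T) ^ p ^ n - 1`. -/
def omega (n : ℕ) : Polynomial ℤ_[p] := (Polynomial.X + 1) ^ p ^ n - 1

theorem omega_monic (n : ℕ) : (omega p n).Monic := by
  have h : ((Polynomial.X + 1 : Polynomial ℤ_[p]) ^ p ^ n).Monic :=
    (Polynomial.monic_X_add_C (1 : ℤ_[p])).pow _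
  refine h.sub_of_left ?_
  rw [show (Polynomial.X + 1 : Polynomial ℤ_[p]) = Polynomial.X + Polynomial.C 1 from rfl,
    Polynomial.degree_pow, Polynomial.degree_X_add_C, Polynomial.degree_one, nsmul_one]
  exact_mod_cast pow_pos (Nat.Prime.pos Fact.out) n

theorem natDegree_omega (n : ℕ) : (omega p n).natDegree = p ^ n := by
  rw [omega, show (1 : Polynomial ℤ_[p]) = Polynomial.C 1 from rfl, Polynomial.natDegree_sub_C,
    Polynomial.natDegree_pow, Polynomial.natDegree_X_add_C, mul_one]

/-- Frobenius modulo `p` turns the polynomial into `T ^ p ^ n`, so all lower coefficients are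
divisible by `p`. -/
theorem omega_isDistinguishedAt (n : ℕ) :
    (omega p n).IsDistinguishedAt (IsLocalRing.maximalIdeal ℤ_[p]) where
  monic := omega_monic p n
  mem {k} hk := by
    rw [natDegree_omega] at hk
    rw [← PadicInt.ker_toZMod, RingHom.mem_ker, ← Polynomial.coeff_map]
    have : Polynomial.map PadicInt.toZMod (omega p n) = Polynomial.X ^ p ^ n := by
      rw [omega, Polynomial.map_sub, Polynomial.map_pow, Polynomial.map_add, Polynomial.map_X,
        Polynomial.map_one, add_pow_char_pow, one_pow, add_sub_cancel_right]
    rw [this, Polynomial.coeff_X_pow, if_neg hk.ne]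

variable {p}

/-- Division with remainder by `(1 + T) ^ p ^ n - 1`. -/
theorem exists_eq_omega_mul_add (n : ℕ) (f : PowerSeries ℤ_[p]) :
    ∃ (q : PowerSeries ℤ_[p]) (r : Polynomial ℤ_[p]), f = omega p n * q + r :=
  ⟨_, _, ((omega_isDistinguishedAt p n).isWeierstrassDivisorAt'.isWeierstrassDivisionAt_div_mod
    f).eq_mul_add⟩

variable {B : Type*} [CommRing B] [Algebra ℤ_[p] B] {b : B} {n : ℕ}

theorem aeval_omega (hb : (1 + b) ^ p ^ n = 1) : Polynomial.aeval b (omega p n) = 0 := by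
  simp [omega, add_comm b, hb]

/-- If `(1 + b) ^ p ^ n = 1`, then power series can be evaluated at `b`. -/
theorem exists_evaluation (hb : (1 + b) ^ p ^ n = 1) :
    ∃ φ : PowerSeries ℤ_[p] →ₐ[ℤ_[p]] B, ∀ f : Polynomial ℤ_[p], φ f = Polynomial.aeval b f := by
  -- By Weierstrass division, polynomials and power series have the same quotient modulo `omega p
  -- n`; evaluation of polynomials at `b` factors through it.
  let e := (omega_isDistinguishedAt p n).algEquivQuotient
  let g : Polynomial ℤ_[p] ⧸ Ideal.span {omega p n} →ₐ[ℤ_[p]] B :=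
    Ideal.Quotient.liftₐ _ (Polynomial.aeval b) fun a ha => by
      obtain ⟨c, rfl⟩ := Ideal.mem_span_singleton'.1 ha
      rw [map_mul, aeval_omega hb, mul_zero]
  refine ⟨(g.comp e.symm.toAlgHom).comp (Ideal.Quotient.mkₐ _ _), fun f => ?_⟩
  have h : e (Ideal.Quotient.mk _ f) = Ideal.Quotient.mk _ (f : PowerSeries ℤ_[p]) := by
    simp [e, Polynomial.IsDistinguishedAt.algEquivQuotient_apply]
  change g (e.symm (Ideal.Quotient.mk _ _)) = _
  rw [← h, AlgEquiv.symm_apply_apply]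
  rfl

theorem algHom_coe_polynomial (φ : PowerSeries ℤ_[p] →ₐ[ℤ_[p]] B) (f : Polynomial ℤ_[p]) :
    φ f = Polynomial.aeval (φ PowerSeries.X) f := by
  have : φ.comp (Polynomial.coeToPowerSeries.algHom ℤ_[p]) =
      Polynomial.aeval (φ PowerSeries.X) := by
    ext
    simp
  rw [← this]
  simp

/-- No continuity is needed: after division by `omega p n`, which both maps kill, only a polynomial
remainder is left. -/
theorem evaluation_unique (hb : (1 + b) ^ p ^ n = 1) {φ ψ : PowerSeries ℤ_[p] →ₐ[ℤ_[p]] B}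
    (hφ : φ PowerSeries.X = b) (hψ : ψ PowerSeries.X = b) : φ = ψ := by
  ext f
  obtain ⟨q, r, rfl⟩ := exists_eq_omega_mul_add n f
  simp only [map_add, map_mul, algHom_coe_polynomial, hφ, hψ, aeval_omega hb, zero_mul]

theorem omega_mem_maximalIdeal_pow (n : ℕ) :
    (omega p n : PowerSeries ℤ_[p]) ∈ IsLocalRing.maximalIdeal (PowerSeries ℤ_[p]) ^ n := by
  have hX : (PowerSeries.X : PowerSeries ℤ_[p]) ∈ IsLocalRing.maximalIdeal _ := by
    rw [IsLocalRing.mem_maximalIdeal, mem_nonunits_iff, PowerSeries.isUnit_iff_constantCoeff]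
    simp
  have hp : (p : PowerSeries ℤ_[p]) ∈ IsLocalRing.maximalIdeal _ := by
    rw [IsLocalRing.mem_maximalIdeal, mem_nonunits_iff, PowerSeries.isUnit_iff_constantCoeff,
      map_natCast]
    exact PadicInt.p_nonunit
  induction n with
  | zero => simp
  | succ n ih =>
    let y : PowerSeries ℤ_[p] := (PowerSeries.X + 1) ^ p ^ n
    have e (k : ℕ) : (omega p k : PowerSeries ℤ_[p]) = (PowerSeries.X + 1) ^ p ^ k - 1 := by
      simp [omega]
    have h1 : y - 1 ∈ IsLocalRing.maximalIdeal (PowerSeries ℤ_[p]) := by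
      have : (PowerSeries.X + 1 : PowerSeries ℤ_[p]) - 1 ∣ y - 1 := sub_one_dvd_pow_sub_one _ _
      rw [add_sub_cancel_right] at this
      exact Ideal.mem_of_dvd _ this hX
    -- This is the factor by which `omega` grows from `n` to `n + 1`. As `y ≡ 1`, the sum is `≡ p ≡
    -- 0` modulo the maximal ideal.
    have h2 : ∑ i ∈ Finset.range p, y ^ i ∈ IsLocalRing.maximalIdeal (PowerSeries ℤ_[p]) := by
      rw [← Ideal.Quotient.eq_zero_iff_mem, map_sum]
      rw [← Ideal.Quotient.eq_zero_iff_mem, map_sub, sub_eq_zero, map_one] at h1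
      rw [← Ideal.Quotient.eq_zero_iff_mem, map_natCast] at hp
      simp [h1, hp]
    rw [e, pow_succ p n, pow_mul, ← mul_geom_sum, pow_succ (IsLocalRing.maximalIdeal _)]
    exact Ideal.mul_mem_mul (e n ▸ ih) h2

/-- Krull's intersection theorem in the Noetherian local ring `ℤ_p⟦T⟧`. -/
theorem eq_zero_of_omega_dvd {f : PowerSeries ℤ_[p]}
    (h : ∀ n, (omega p n : PowerSeries ℤ_[p]) ∣ f) : f = 0 := by
  have := Ideal.iInf_pow_eq_bot_of_isLocalRing (IsLocalRing.maximalIdeal (PowerSeries ℤ_[p]))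
    (IsLocalRing.maximalIdeal.isMaximal _).ne_top
  rw [← Ideal.mem_bot, ← this, Ideal.mem_iInf]
  exact fun n => Ideal.mem_of_dvd _ (h n) (omega_mem_maximalIdeal_pow n)

end Evaluation

/-! ### Solving linear equations in `Λ(H)` level by level. -/

section Compactness

open scoped PowerSeries.WithPiTopology

variable {p : ℕ} [Fact p.Prime]

instance : CompactSpace (PowerSeries ℤ_[p]) :=
  inferInstanceAs (CompactSpace ((Unit →₀ ℕ) → ℤ_[p]))

/-- By Noetherianity `K` is the image of some compact `ℤ_p⟦T⟧ⁿ` under a continuous linear map. -/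
theorem isCompact_submodule {ι : Type*} [Finite ι]
    (K : Submodule (PowerSeries ℤ_[p]) (ι → PowerSeries ℤ_[p])) :
    IsCompact (K : Set (ι → PowerSeries ℤ_[p])) := by
  obtain ⟨n, v, hv⟩ := Submodule.fg_iff_exists_fin_generating_family.1 (IsNoetherian.noetherian K)
  let L := Fintype.linearCombination (PowerSeries ℤ_[p]) v
  have hL : Continuous L := by
    refine continuous_pi fun i => ?_
    simp only [L, Fintype.linearCombination_apply, Finset.sum_apply, Pi.smul_apply, smul_eq_mul]
    fun_prop
  have : (K : Set (ι → PowerSeries ℤ_[p])) = Set.range L := by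
    rw [← hv, ← LinearMap.coe_range, Fintype.range_linearCombination]
  rw [this]
  exact isCompact_range hL

/-- The solutions at level `N` form a nonempty coset of a submodule, hence a compact set. These sets
form a directed family, so they have a common point, and no topology on `Λ(H)` is required. -/
theorem exists_linearCombination {H : Type u} [Group H] [TopologicalSpace H]
    [IsMulCommutative H] (Φ : PowerSeries ℤ_[p] →ₐ[ℤ_[p]] IwasawaAlgebra p H)
    {ι : Type*} [Fintype ι] (b : ι → IwasawaAlgebra p H)
    (h : ∀ (N : OpenNormalSubgroup H) (x : MonoidAlgebra ℤ_[p] (H ⧸ N.toSubgroup)),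
      ∃ a : ι → PowerSeries ℤ_[p], proj p N (∑ i, Φ (a i) * b i) = x) (x : IwasawaAlgebra p H) :
    ∃ a : ι → PowerSeries ℤ_[p], ∑ i, Φ (a i) * b i = x := by
  let S (N : OpenNormalSubgroup H) : Set (ι → PowerSeries ℤ_[p]) :=
    {a | proj p N (∑ i, Φ (a i) * b i) = proj p N x}
  have hne (N) : (S N).Nonempty := h N (proj p N x)
  have hc (N) : IsCompact (S N) := by
    obtain ⟨a₀, h₀⟩ := hne N
    let K : Submodule (PowerSeries ℤ_[p]) (ι → PowerSeries ℤ_[p]) :=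
      { carrier := {a | proj p N (∑ i, Φ (a i) * b i) = 0}
        zero_mem' := by simp
        add_mem' := fun {a c} ha hc => by
          simp only [Set.mem_ofPred_eq, Pi.add_apply, map_add, add_mul, Finset.sum_add_distrib] at *
          rw [ha, hc, add_zero]
        smul_mem' := fun r a ha => by
          simp only [Set.mem_ofPred_eq, Pi.smul_apply, smul_eq_mul, map_mul, mul_assoc,
            ← Finset.mul_sum] at *
          rw [ha, mul_zero] }
    have : S N = (fun a => a₀ + a) '' K := by
      ext a
      refine ⟨fun ha => ⟨a - a₀, ?_, add_sub_cancel _ _⟩, ?_⟩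
      · change proj p N (∑ i, Φ (a i - a₀ i) * b i) = 0
        simp only [map_sub, sub_mul, Finset.sum_sub_distrib]
        rw [show proj p N (∑ i, Φ (a i) * b i) = proj p N x from ha,
          show proj p N (∑ i, Φ (a₀ i) * b i) = proj p N x from h₀, sub_self]
      · rintro ⟨c, hc, rfl⟩
        change proj p N (∑ i, Φ (a₀ i + c i) * b i) = proj p N x
        simp only [map_add, add_mul, Finset.sum_add_distrib]
        rw [show proj p N (∑ i, Φ (a₀ i) * b i) = proj p N x from h₀,
          show proj p N (∑ i, Φ (c i) * b i) = 0 from hc, add_zero]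
    rw [this]
    exact (isCompact_submodule K).image (continuous_const_add a₀)
  have hmono {N N' : OpenNormalSubgroup H} (hN : N.toSubgroup ≤ N'.toSubgroup) : S N ⊆ S N' := by
    intro a ha
    change proj p N' _ = proj p N' x
    rw [← transition_proj hN, ← transition_proj hN x, show proj p N _ = proj p N x from ha]
  have : Nonempty (OpenNormalSubgroup H) := ⟨topSubgroup H⟩
  obtain ⟨a, ha⟩ := IsCompact.nonempty_iInter_of_directed_nonempty_isCompact_isClosed S
    (fun N N' => ⟨N ⊓ N', hmono inf_le_left, hmono inf_le_right⟩) hne hc fun N => (hc N).isClosed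
  exact ⟨a, ext_proj fun N => Set.mem_iInter.1 ha N⟩

end Compactness

/-! ### Power series in `γ - 1` inside the Iwasawa algebra. -/

section TopologicalGenerator

variable {p : ℕ} [Fact p.Prime] {H : Type u} [CommGroup H] [TopologicalSpace H] {γ : H}

/-- If `γ ^ p ^ n → 1`, then power series can be evaluated at `γ - 1` in the Iwasawa algebra. -/
theorem exists_evaluation_iwasawa (h : ∀ N : OpenNormalSubgroup H, ∃ n, γ ^ p ^ n ∈ N.toSubgroup) :
    ∃ Φ : PowerSeries ℤ_[p] →ₐ[ℤ_[p]] IwasawaAlgebra p H, Φ PowerSeries.X = of p γ - 1 := by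
  choose n hn using h
  have hb (N : OpenNormalSubgroup H) {k : ℕ} (hk : γ ^ p ^ k ∈ N.toSubgroup) :
      (1 + proj p N (of p γ - 1)) ^ p ^ k = 1 := by
    rw [map_sub, map_one, add_sub_cancel, ← map_pow, ← map_pow, proj_of,
      (QuotientGroup.eq_one_iff _).2 hk, map_one]
  choose φ hφ using fun N => exists_evaluation (hb N (hn N))
  have hX (N) : φ N PowerSeries.X = proj p N (of p γ - 1) := by
    simpa using hφ N Polynomial.X
  refine ⟨liftProj φ fun N N' hN a => ?_, ext_proj fun N => hX N⟩
  refine DFunLike.congr_fun (evaluation_unique (φ := (transition p H hN).comp (φ N)) (ψ := φ N')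
    (hb N' (hn N')) ?_ (hX N')) a
  rw [AlgHom.comp_apply, hX, transition_proj]

variable {Φ : PowerSeries ℤ_[p] →ₐ[ℤ_[p]] IwasawaAlgebra p H}

theorem exists_eq_sum (hΦ : Φ PowerSeries.X = of p γ - 1) {ι : Type*} [Fintype ι] (d : ι → H)
    (h : ∀ (N : OpenNormalSubgroup H) (g : H), ∃ (k : ℕ) (i : ι),
      (g : H ⧸ N.toSubgroup) = ((γ ^ k * d i : H) : H ⧸ N.toSubgroup)) (x : IwasawaAlgebra p H) :
    ∃ a : ι → PowerSeries ℤ_[p], ∑ i, Φ (a i) * of p (d i) = x := by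
  classical
  refine exists_linearCombination Φ _ (fun N y => ?_) x
  induction y using MonoidAlgebra.induction_linear with
  | zero => exact ⟨0, by simp⟩
  | add y z hy hz =>
    obtain ⟨a, rfl⟩ := hy
    obtain ⟨c, rfl⟩ := hz
    exact ⟨a + c, by simp [add_mul, Finset.sum_add_distrib]⟩
  | single g r =>
    induction g using QuotientGroup.induction_on with | _ g
    obtain ⟨k, i, hk⟩ := h N g
    -- `Φ` sends `1 + T` to `γ`, so this vector represents `r γ ^ k d i`.
    refine ⟨Pi.single i (r • (1 + PowerSeries.X) ^ k), ?_⟩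
    rw [Finset.sum_eq_single i (fun j _ hj => by simp [Pi.single_eq_of_ne hj]) (by simp),
      Pi.single_eq_same, map_smul, map_pow, map_add, map_one, hΦ, add_sub_cancel, smul_mul_assoc,
      map_smul, ← map_pow, ← map_mul, proj_of, hk, MonoidAlgebra.of_apply,
      MonoidAlgebra.smul_single, smul_eq_mul, mul_one]

/-- At a level where `γ` has order exactly `p ^ n`, its powers below `p ^ n` are linearly
independent, so a polynomial vanishing at `γ` is divisible by `X ^ p ^ n - 1`. An element of the
kernel is therefore divisible by every `omega p n`. -/
theorem evaluation_injective (hΦ : Φ PowerSeries.X = of p γ - 1)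
    (h : ∀ n, ∃ N : OpenNormalSubgroup H, ∀ k, γ ^ k ∈ N.toSubgroup ↔ p ^ n ∣ k) :
    Function.Injective Φ := by
  refine (injective_iff_map_eq_zero Φ).2 fun f hf => eq_zero_of_omega_dvd fun n => ?_
  obtain ⟨N, hN⟩ := h n
  obtain ⟨q, r, rfl⟩ := exists_eq_omega_mul_add n f
  have hb : (1 + proj p N (of p γ - 1)) ^ p ^ n = 1 := by
    rw [map_sub, map_one, add_sub_cancel, ← map_pow, ← map_pow, proj_of,
      (QuotientGroup.eq_one_iff _).2 ((hN _).2 dvd_rfl), map_one]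
  have h1 : Polynomial.aeval (proj p N (of p γ - 1)) r = 0 := by
    have h2 := congrArg (proj p N) hf
    rw [map_zero, ← AlgHom.comp_apply, map_add, map_mul, algHom_coe_polynomial,
      algHom_coe_polynomial, AlgHom.comp_apply, hΦ, aeval_omega hb, zero_mul, zero_add] at h2
    exact h2
  -- Change of variable from `γ - 1` to `γ`.
  let s := r.comp (Polynomial.X - 1)
  have hs : Polynomial.aeval (proj p N (of p γ)) s = 0 := by
    simp only [s, Polynomial.aeval_comp]
    simpa using h1
  have hm : (Polynomial.X ^ p ^ n - 1 : Polynomial ℤ_[p]).Monic :=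
    Polynomial.monic_X_pow_sub_C (1 : ℤ_[p]) (pow_ne_zero _ (Nat.Prime.ne_zero Fact.out))
  have hdvd : (Polynomial.X ^ p ^ n - 1 : Polynomial ℤ_[p]) ∣ s := by
    rw [← Polynomial.modByMonic_eq_zero_iff_dvd hm]
    have ho : orderOf (γ : H ⧸ N.toSubgroup) = p ^ n := Nat.dvd_right_iff_eq.1 fun k => by
      rw [orderOf_dvd_iff_pow_eq_one, ← hN, ← QuotientGroup.mk_pow, QuotientGroup.eq_one_iff]
    have hd : (s %ₘ (Polynomial.X ^ p ^ n - 1)).natDegree < p ^ n := by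
      have h3 : (Polynomial.X ^ p ^ n - 1 : Polynomial ℤ_[p]).natDegree = p ^ n :=
        Polynomial.natDegree_X_pow_sub_C
      exact (Polynomial.natDegree_modByMonic_lt s hm fun h4 => by
        rw [h4, Polynomial.natDegree_one] at h3
        exact (pow_ne_zero n (Nat.Prime.ne_zero (Fact.out : p.Prime))) h3.symm).trans_eq h3
    have h0 : Polynomial.aeval (proj p N (of p γ)) (s %ₘ (Polynomial.X ^ p ^ n - 1)) = 0 := by
      rw [← Polynomial.modByMonic_add_div s (Polynomial.X ^ p ^ n - 1), map_add, map_mul, map_sub,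
        map_pow, Polynomial.aeval_X, map_one] at hs
      rw [map_sub, map_one, add_sub_cancel] at hb
      rwa [hb, sub_self, zero_mul, add_zero] at hs
    rw [Polynomial.aeval_eq_sum_range' hd] at h0
    ext j
    rcases lt_or_ge j (p ^ n) with hj | hj
    · have h5 := congrArg (fun x => x.coeff ((γ : H ⧸ N.toSubgroup) ^ j)) h0
      have h6 : ∀ i ∈ Finset.range (p ^ n), i ≠ j →
          (γ : H ⧸ N.toSubgroup) ^ i ≠ (γ : H ⧸ N.toSubgroup) ^ j := fun i hi hij h7 => by
        rw [← ho] at hi hj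
        exact hij (pow_injOn_Iio_orderOf (Finset.mem_range.1 hi) hj h7)
      simp only [MonoidAlgebra.coeff_sum, Finsupp.finsetSum_apply, MonoidAlgebra.coeff_zero,
        Finsupp.zero_apply, MonoidAlgebra.coeff_smul_apply, proj_of,
        MonoidAlgebra.of_apply, MonoidAlgebra.single_pow, one_pow,
        MonoidAlgebra.coeff_single] at h5
      rw [Finset.sum_eq_single_of_mem j (Finset.mem_range.2 hj)
        fun i hi hij => by rw [Finsupp.single_eq_of_ne (h6 i hi hij).symm, smul_zero],
        Finsupp.single_eq_same, smul_eq_mul, mul_one] at h5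
      rw [h5, Polynomial.coeff_zero]
    · exact Polynomial.coeff_eq_zero_of_natDegree_lt (hd.trans_le hj)
  obtain ⟨c, hc⟩ := hdvd
  have hr : r = omega p n * c.comp (Polynomial.X + 1) := by
    have : r = s.comp (Polynomial.X + 1) := by simp [s, Polynomial.comp_assoc]
    rw [this, hc, Polynomial.mul_comp]
    simp [omega]
  rw [hr, Polynomial.coe_mul]
  exact dvd_add (dvd_mul_right _ _) (dvd_mul_right _ _)

end TopologicalGenerator

/-! ### Open subgroups of a group isomorphic to `ℤ_p`. -/

section PadicGroup

variable {p : ℕ} [Fact p.Prime] {H : Type u} [CommGroup H] [TopologicalSpace H]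
  (e : H ≃ₜ* Multiplicative ℤ_[p])

/-- The topological generator of a group isomorphic to `ℤ_p`. -/
def generator : H := e.symm (Multiplicative.ofAdd 1)

theorem generator_pow (k : ℕ) : generator e ^ k = e.symm (Multiplicative.ofAdd (k : ℤ_[p])) := by
  rw [generator, ← map_pow, ← ofAdd_nsmul, nsmul_one]

theorem exists_span_le (N : OpenNormalSubgroup H) :
    ∃ n, ∀ x ∈ Ideal.span {(p : ℤ_[p]) ^ n}, e.symm (Multiplicative.ofAdd x) ∈ N.toSubgroup := by
  have ho : IsOpen {x : ℤ_[p] | e.symm (Multiplicative.ofAdd x) ∈ N.toSubgroup} :=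
    N.isOpen'.preimage (e.symm.continuous.comp continuous_ofAdd)
  obtain ⟨ε, hε, h⟩ := Metric.isOpen_iff.1 ho 0 (by
    change e.symm 1 ∈ N.toSubgroup
    rw [map_one]
    exact one_mem _)
  obtain ⟨n, hn⟩ := PadicInt.exists_pow_neg_lt p hε
  refine ⟨n, fun x hx => h ?_⟩
  rw [mem_ball_zero_iff]
  exact ((PadicInt.norm_le_pow_iff_mem_span_pow x n).2 hx).trans_lt hn

theorem exists_generator_pow_mem (N : OpenNormalSubgroup H) :
    ∃ n, generator e ^ p ^ n ∈ N.toSubgroup := by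
  obtain ⟨n, hn⟩ := exists_span_le e N
  refine ⟨n, ?_⟩
  rw [generator_pow]
  exact hn _ (by simp)

theorem exists_eq_generator_pow (N : OpenNormalSubgroup H) (g : H) :
    ∃ k : ℕ, (g : H ⧸ N.toSubgroup) = ((generator e ^ k : H) : H ⧸ N.toSubgroup) := by
  obtain ⟨n, hn⟩ := exists_span_le e N
  obtain ⟨x, rfl⟩ := e.symm.surjective g
  -- `appr n` is a natural number congruent to the given `p`-adic integer modulo `p ^ n`.
  refine ⟨x.toAdd.appr n, Eq.symm ?_⟩
  rw [generator_pow, QuotientGroup.eq, ← map_inv, ← map_mul]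
  convert hn _ (PadicInt.appr_spec n x.toAdd) using 2
  rw [ofAdd_sub, ofAdd_toAdd, div_eq_mul_inv, mul_comm]

theorem exists_generator_pow_mem_iff (n : ℕ) :
    ∃ N : OpenNormalSubgroup H, ∀ k, generator e ^ k ∈ N.toSubgroup ↔ p ^ n ∣ k := by
  let S : Subgroup H := (Ideal.span {(p : ℤ_[p]) ^ n}).toAddSubgroup.toSubgroup.comap
    e.toMulEquiv.toMonoidHom
  have ho : IsOpen (S : Set H) := by
    have h1 : IsOpen (Ideal.span {(p : ℤ_[p]) ^ n} : Set ℤ_[p]) := by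
      have : (Ideal.span {(p : ℤ_[p]) ^ n} : Set ℤ_[p]) =
          Metric.closedBall 0 ((p : ℝ) ^ (-n : ℤ)) := by
        ext x
        rw [mem_closedBall_zero_iff, PadicInt.norm_le_pow_iff_mem_span_pow]
        rfl
      rw [this]
      exact IsUltrametricDist.isOpen_closedBall _
        (zpow_ne_zero _ (Nat.cast_ne_zero.2 (Nat.Prime.ne_zero Fact.out)))
    exact h1.preimage (continuous_toAdd.comp e.continuous)
  refine ⟨{ toSubgroup := S, isOpen' := ho, isNormal' := inferInstance }, fun k => ?_⟩
  change (e (generator e ^ k)).toAdd ∈ Ideal.span {(p : ℤ_[p]) ^ n} ↔ _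
  rw [generator_pow, ContinuousMulEquiv.apply_symm_apply, toAdd_ofAdd, Ideal.mem_span_singleton]
  exact_mod_cast PadicInt.pow_p_dvd_int_iff n k

end PadicGroup

/-! ### The isomorphism `ℤ_p⟦T⟧ ≅ Λ(Γ)` and its consequences. -/

section PowerSeries

variable {p : ℕ} [Fact p.Prime] {H : Type u} [CommGroup H] [TopologicalSpace H]
  (e : H ≃ₜ* Multiplicative ℤ_[p])

/-- The Iwasawa algebra of a group isomorphic to `ℤ_p` is the ring of power series over `ℤ_p`. -/
theorem exists_powerSeries_equiv : ∃ E : PowerSeries ℤ_[p] ≃ₐ[ℤ_[p]] IwasawaAlgebra p H,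
    E PowerSeries.X = of p (generator e) - 1 := by
  obtain ⟨Φ, hΦ⟩ := exists_evaluation_iwasawa (exists_generator_pow_mem e)
  refine ⟨AlgEquiv.ofBijective Φ
    ⟨evaluation_injective hΦ (exists_generator_pow_mem_iff e), fun x => ?_⟩, hΦ⟩
  obtain ⟨a, ha⟩ := exists_eq_sum hΦ (fun _ : Unit => (1 : H)) (fun N g => by
    obtain ⟨k, hk⟩ := exists_eq_generator_pow e N g
    exact ⟨k, (), by rw [mul_one, hk]⟩) x
  exact ⟨a (), by simpa using ha⟩

theorem isDomain_iwasawa (e : H ≃ₜ* Multiplicative ℤ_[p]) : IsDomain (IwasawaAlgebra p H) :=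
  have ⟨E, _⟩ := exists_powerSeries_equiv e
  E.symm.toRingEquiv.toMulEquiv.isDomain _

theorem isNoetherianRing_iwasawa (e : H ≃ₜ* Multiplicative ℤ_[p]) :
    IsNoetherianRing (IwasawaAlgebra p H) :=
  have ⟨E, _⟩ := exists_powerSeries_equiv e
  isNoetherianRing_of_ringEquiv _ E.toRingEquiv

theorem generator_sub_one_ne_zero : of p (generator e) - 1 ≠ 0 := by
  obtain ⟨E, hE⟩ := exists_powerSeries_equiv e
  rw [← hE, Ne, EmbeddingLike.map_eq_zero_iff]
  exact PowerSeries.X_ne_zero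

/-- Under the isomorphism with `ℤ_p⟦T⟧`, the residue modulo `T` is the constant coefficient and the
quotient is the shifted series. -/
theorem isResidueRing_iwasawa : IsResidueRing ℤ_[p] (of p (generator e) - 1) := by
  obtain ⟨E, hE⟩ := exists_powerSeries_equiv e
  constructor
  · intro a
    obtain ⟨f, rfl⟩ := E.surjective a
    refine ⟨PowerSeries.constantCoeff f,
      E (PowerSeries.mk fun n => PowerSeries.coeff (n + 1) f), ?_⟩
    rw [← hE, ← map_mul, ← E.commutes, ← map_add]
    exact congrArg E ((PowerSeries.eq_X_mul_shift_add_const f).trans (add_comm _ _))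
  · intro r h
    rw [← hE, ← E.commutes, map_dvd_iff, PowerSeries.X_dvd_iff] at h
    simpa using h

end PowerSeries

/-! ### `Λ(G)` over `Λ(Γ)` for `G = Γ × Δ`. -/

section Complement

theorem quotientMulEquiv_mk {G : Type u} [CommGroup G] {Γ Δ : Subgroup G}
    (hc : Δ.IsComplement' Γ) (γ : Γ) (δ : Δ) :
    hc.symm.QuotientMulEquiv ((γ * δ : G) : G ⧸ Δ) = γ := by
  have h : ((γ * δ : G) : G ⧸ Δ) = hc.symm.QuotientMulEquiv.symm γ :=
    QuotientGroup.mk_mul_of_mem _ δ.2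
  simp [h]

/-- Needed to split `Λ(Γ) → Λ(G)` by the projection `G → Γ`. At level `N` the composite is read off
from the preimage of `N` under `g ∘ f`, which lies in `N`. -/
theorem map_leftInverse {p : ℕ} [Fact p.Prime] {H : Type u} [Group H] [TopologicalSpace H]
    {G : Type v} [Group G] [TopologicalSpace G] {f : H →ₜ* G} {g : G →ₜ* H}
    (h : ∀ x, g (f x) = x) (x : IwasawaAlgebra p H) : map p g (map p f x) = x := by
  refine ext_proj fun N => ?_
  have h' : (comapSubgroup f (comapSubgroup g N)).toSubgroup ≤ N.toSubgroup := fun y hy => by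
    have : g (f y) ∈ N.toSubgroup := hy
    rwa [h] at this
  rw [map, proj_liftProj, AlgHom.comp_apply, map, proj_liftProj, AlgHom.comp_apply,
    ← transition_proj h' x]
  generalize proj p (comapSubgroup f (comapSubgroup g N)) x = b
  induction b using MonoidAlgebra.induction_linear with
  | zero => simp
  | add x y hx hy => simp only [map_add, hx, hy]
  | single y r =>
    induction y using QuotientGroup.induction_on with | _ y
    simp only [transition, MonoidAlgebra.mapDomainAlgHom_apply, MonoidAlgebra.mapDomain_single]
    change MonoidAlgebra.single ((g (f y) : H) : H ⧸ N.toSubgroup) r = _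
    rw [h]
    rfl

variable {p : ℕ} [Fact p.Prime] {G : Type u} [CommGroup G] [TopologicalSpace G]
  {Γ Δ : Subgroup G}

theorem algebraMap_of (γ : Γ) :
    algebraMap (IwasawaAlgebra p Γ) (IwasawaAlgebra p G) (of p γ) = of p (γ : G) :=
  map_of p _ γ

theorem algebraMap_smul_one (r : ℤ_[p]) (x : IwasawaAlgebra p Γ) :
    algebraMap (IwasawaAlgebra p Γ) (IwasawaAlgebra p G) (r • x) =
      r • algebraMap (IwasawaAlgebra p Γ) (IwasawaAlgebra p G) x :=
  _root_.map_smul (map p ⟨Γ.subtype, continuous_subtype_val⟩ :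
    IwasawaAlgebra p Γ →ₐ[ℤ_[p]] IwasawaAlgebra p G) r x

/-- Every element of `Λ(G)` is a combination of the elements of `Δ` with coefficients in
`Λ(Γ)`. -/
theorem exists_eq_sum_algebraMap [Fintype Δ] (e : Γ ≃ₜ* Multiplicative ℤ_[p])
    (hc : Δ.IsComplement' Γ) (x : IwasawaAlgebra p G) :
    ∃ a : Δ → IwasawaAlgebra p Γ,
      ∑ δ, algebraMap _ (IwasawaAlgebra p G) (a δ) * of p (δ : G) = x := by
  obtain ⟨E, hE⟩ := exists_powerSeries_equiv e
  let Φ : PowerSeries ℤ_[p] →ₐ[ℤ_[p]] IwasawaAlgebra p G :=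
    (map p ⟨Γ.subtype, continuous_subtype_val⟩).comp E.toAlgHom
  have hΦ : Φ PowerSeries.X = of p ((generator e : Γ) : G) - 1 := by
    change map p _ (E PowerSeries.X) = _
    rw [hE, map_sub, map_one, map_of]
    rfl
  obtain ⟨a, ha⟩ := exists_eq_sum hΦ (fun δ : Δ => (δ : G)) (fun N g => by
    obtain ⟨⟨δ, γ⟩, rfl⟩ := hc.2 g
    obtain ⟨k, hk⟩ := exists_eq_generator_pow e
      (comapSubgroup ⟨Γ.subtype, continuous_subtype_val⟩ N) γ
    refine ⟨k, δ, ?_⟩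
    rw [mul_comm, QuotientGroup.mk_mul, QuotientGroup.mk_mul]
    congr 1
    rw [QuotientGroup.eq] at hk ⊢
    exact hk) x
  exact ⟨fun δ => E (a δ), ha⟩

theorem finite_iwasawa [Finite Δ] (e : Γ ≃ₜ* Multiplicative ℤ_[p]) (hc : Δ.IsComplement' Γ) :
    Module.Finite (IwasawaAlgebra p Γ) (IwasawaAlgebra p G) := by
  have := Fintype.ofFinite Δ
  have h : Submodule.span (IwasawaAlgebra p Γ) (Set.range fun δ : Δ => of p (δ : G)) = ⊤ := by
    refine Submodule.eq_top_iff'.2 fun x => ?_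
    obtain ⟨a, rfl⟩ := exists_eq_sum_algebraMap e hc x
    refine sum_mem fun δ _ => ?_
    rw [← Algebra.smul_def]
    exact Submodule.smul_mem _ _ (Submodule.subset_span ⟨δ, rfl⟩)
  exact ⟨h ▸ Submodule.fg_span (Set.finite_range _)⟩

/-- The projection `G = Γ × Δ → Γ`. -/
def retraction [IsTopologicalGroup G] (hc : Δ.IsComplement' Γ) (ho : IsOpen (Γ : Set G)) :
    G →ₜ* Γ where
  toMonoidHom := hc.symm.QuotientMulEquiv.toMonoidHom.comp (QuotientGroup.mk' Δ)
  continuous_toFun := by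
    -- For a homomorphism continuity at `1` suffices, and on the open neighbourhood `Γ` of `1` the
    -- projection is the identity.
    refine continuous_of_continuousAt_one
      (hc.symm.QuotientMulEquiv.toMonoidHom.comp (QuotientGroup.mk' Δ)) ?_
    rw [Topology.IsInducing.subtypeVal.continuousAt_iff]
    refine (continuousAt_id (X := G)).congr ?_
    filter_upwards [ho.mem_nhds (one_mem Γ)] with x hx
    have := quotientMulEquiv_mk hc ⟨x, hx⟩ 1
    rw [OneMemClass.coe_one, mul_one] at this
    exact (congrArg Subtype.val this).symm

theorem retraction_apply [IsTopologicalGroup G] (hc : Δ.IsComplement' Γ)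
    (ho : IsOpen (Γ : Set G)) (γ : Γ) (δ : Δ) : retraction hc ho (γ * δ) = γ :=
  quotientMulEquiv_mk hc γ δ

end Complement

/-! ### The idempotent of `Δ` and the generator of the augmentation ideal. -/

section Idempotent

variable {p : ℕ} [Fact p.Prime] {G : Type u} [CommGroup G] [TopologicalSpace G]
  {Γ Δ : Subgroup G}

variable (p Δ) in
/-- The idempotent `|Δ|⁻¹ ∑ δ` of `Λ(G)`, for a finite subgroup `Δ`. -/
def averaging [Fintype Δ] : IwasawaAlgebra p G :=
  Ring.inverse (Fintype.card Δ : ℤ_[p]) • ∑ δ : Δ, of p (δ : G)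

variable [Fintype Δ]

theorem averaging_mul_of (δ : Δ) : averaging p Δ * of p (δ : G) = averaging p Δ := by
  rw [averaging, smul_mul_assoc, Finset.sum_mul]
  congr 1
  refine Fintype.sum_equiv (Equiv.mulRight δ) _ _ fun x => ?_
  rw [← map_mul]
  rfl

/-- An average of equal values. The unit hypothesis matters because `Ring.inverse` is `0` on
non-units. -/
theorem algHom_averaging {B : Type*} [Ring B] [Algebra ℤ_[p] B]
    (hΔ : IsUnit (Fintype.card Δ : ℤ_[p])) (f : IwasawaAlgebra p G →ₐ[ℤ_[p]] B) (b : B)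
    (hf : ∀ δ : Δ, f (of p (δ : G)) = b) : f (averaging p Δ) = b := by
  rw [averaging, map_smul, map_sum, Finset.sum_congr rfl fun δ _ => hf δ, Finset.sum_const,
    Finset.card_univ, ← Nat.cast_smul_eq_nsmul ℤ_[p], smul_smul, Ring.inverse_mul_cancel _ hΔ,
    one_smul]

theorem averaging_mul_self (hΔ : IsUnit (Fintype.card Δ : ℤ_[p])) :
    averaging p Δ * averaging p Δ = averaging p Δ := by
  nth_rw 2 [averaging]
  rw [mul_smul_comm, Finset.mul_sum, Finset.sum_congr rfl fun δ _ => averaging_mul_of δ,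
    Finset.sum_const, Finset.card_univ, ← Nat.cast_smul_eq_nsmul ℤ_[p], smul_smul,
    Ring.inverse_mul_cancel _ hΔ, one_smul]

/-- An element of `Λ(G)` equal to `t` on the image of the idempotent `averaging p Δ` and to `1` on
its kernel. -/
def koszul (Δ : Subgroup G) [Fintype Δ] (t : IwasawaAlgebra p G) : IwasawaAlgebra p G :=
  t * averaging p Δ + (1 - averaging p Δ)

/-- The idempotent absorbs `Δ`, and `Λ(G)` is spanned by `Δ` over `Λ(Γ)`. -/
theorem exists_averaging_mul_eq (e : Γ ≃ₜ* Multiplicative ℤ_[p]) (hc : Δ.IsComplement' Γ)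
    (x : IwasawaAlgebra p G) :
    ∃ a : IwasawaAlgebra p Γ, averaging p Δ * x = averaging p Δ * algebraMap _ _ a := by
  obtain ⟨a, rfl⟩ := exists_eq_sum_algebraMap e hc x
  refine ⟨∑ δ, a δ, ?_⟩
  rw [map_sum, Finset.mul_sum, Finset.mul_sum]
  refine Finset.sum_congr rfl fun δ _ => ?_
  rw [mul_comm (algebraMap _ _ _), ← mul_assoc, averaging_mul_of]

theorem averaging_mul_koszul (hΔ : IsUnit (Fintype.card Δ : ℤ_[p])) (t : IwasawaAlgebra p G) :
    averaging p Δ * koszul Δ t = averaging p Δ * t := by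
  linear_combination (norm := (rw [koszul]; ring_nf)) (t - 1) * averaging_mul_self hΔ

theorem one_sub_averaging_mul_koszul (hΔ : IsUnit (Fintype.card Δ : ℤ_[p]))
    (t : IwasawaAlgebra p G) : (1 - averaging p Δ) * koszul Δ t = 1 - averaging p Δ := by
  linear_combination (norm := (rw [koszul]; ring_nf)) (1 - t) * averaging_mul_self hΔ

/-- If `sy = 0` then `(1 - e) y = 0` and `t e y = 0`. Write `e y = e a` with `a ∈ Λ(Γ)`; the
retraction to `Λ(Γ)` sends `e` to `1`, so `t a = 0` in a domain and `a = 0`. -/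
theorem isRegular_koszul [IsTopologicalGroup G] (hΔ : IsUnit (Fintype.card Δ : ℤ_[p]))
    (e : Γ ≃ₜ* Multiplicative ℤ_[p]) (hc : Δ.IsComplement' Γ) (ho : IsOpen (Γ : Set G))
    {t : IwasawaAlgebra p Γ} (ht : t ≠ 0) :
    IsRegular (koszul Δ (algebraMap _ (IwasawaAlgebra p G) t)) := by
  have := isDomain_iwasawa e
  rw [isRegular_iff_mem_nonZeroDivisors, mem_nonZeroDivisors_iff_right]
  intro y hy
  set s := koszul Δ (algebraMap _ (IwasawaAlgebra p G) t)
  have h1 : (1 - averaging p Δ) * y = 0 := by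
    rw [← one_sub_averaging_mul_koszul hΔ (algebraMap _ _ t), mul_assoc, mul_comm _ y, hy, mul_zero]
  have h2 : averaging p Δ * y * algebraMap _ _ t = 0 := by
    rw [mul_right_comm, ← averaging_mul_koszul hΔ, mul_assoc, mul_comm _ y, hy, mul_zero]
  have h3 : y = averaging p Δ * y := by linear_combination h1
  obtain ⟨a, ha⟩ := exists_averaging_mul_eq (p := p) e hc y
  let q : IwasawaAlgebra p G →ₐ[ℤ_[p]] IwasawaAlgebra p Γ := map p (retraction hc ho)
  have hq (δ : Δ) : q (of p (δ : G)) = 1 := by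
    have := retraction_apply hc ho 1 δ
    rw [OneMemClass.coe_one, one_mul] at this
    rw [map_of, this, map_one]
  have hq' (x : IwasawaAlgebra p Γ) : q (algebraMap _ _ x) = x :=
    map_leftInverse (fun γ => by
      have := retraction_apply hc ho γ 1
      rwa [OneMemClass.coe_one, mul_one] at this) x
  have h4 := congrArg q h2
  rw [ha, map_mul, map_mul, algHom_averaging hΔ q 1 hq, hq', hq', one_mul, map_zero] at h4
  rw [h3, ha, (mul_eq_zero.1 h4).resolve_right ht, map_zero, mul_zero]

/-- Let `y ∈ I(G)`. Then `(1 - e) y = (1 - e) s y`. Also `e y = e (r + t b)` with `r ∈ ℤ_p`;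
augmenting gives `r = 0`, and `e t b = e s b`. -/
theorem augmentationIdeal_eq_span_koszul (hΔ : IsUnit (Fintype.card Δ : ℤ_[p]))
    (e : Γ ≃ₜ* Multiplicative ℤ_[p]) (hc : Δ.IsComplement' Γ) :
    augmentationIdeal p G =
      Ideal.span {koszul Δ (algebraMap _ (IwasawaAlgebra p G) (of p (generator e) - 1))} := by
  have ha := algHom_averaging hΔ (augmentation p G) 1 fun δ => augmentation_of p (δ : G)
  have ht : augmentation p G (algebraMap _ _ (of p (generator e) - 1)) = 0 := by
    rw [map_sub, map_one, algebraMap_of, map_sub, augmentation_of, map_one, sub_self]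
  refine le_antisymm (fun y hy => ?_) ?_
  · have h1 : (1 - averaging p Δ) * y ∈
        Ideal.span {koszul Δ (algebraMap _ (IwasawaAlgebra p G) (of p (generator e) - 1))} := by
      rw [← one_sub_averaging_mul_koszul hΔ (algebraMap _ _ (of p (generator e) - 1)),
        mul_right_comm]
      exact Ideal.mul_mem_left _ _ (Ideal.mem_span_singleton_self _)
    obtain ⟨a, hae⟩ := exists_averaging_mul_eq (p := p) e hc y
    obtain ⟨r, b, rfl⟩ := (isResidueRing_iwasawa e).exists_eq a
    have hr : algebraMap (IwasawaAlgebra p Γ) (IwasawaAlgebra p G) (algebraMap ℤ_[p] _ r) =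
        algebraMap ℤ_[p] _ r :=
      (map p ⟨Γ.subtype, continuous_subtype_val⟩ :
        IwasawaAlgebra p Γ →ₐ[ℤ_[p]] IwasawaAlgebra p G).commutes r
    have h0 := congrArg (augmentation p G) hae
    rw [map_mul, map_mul, ha, map_add, map_mul, map_add, map_mul, ht, hr, AlgHom.commutes,
      show augmentation p G y = 0 from hy] at h0
    have h00 : r = 0 := by simpa using h0.symm
    have h2 : averaging p Δ * y ∈
        Ideal.span {koszul Δ (algebraMap _ (IwasawaAlgebra p G) (of p (generator e) - 1))} := by
      rw [hae, h00, map_zero, zero_add, map_mul, ← mul_assoc, ← averaging_mul_koszul hΔ,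
        mul_right_comm]
      exact Ideal.mul_mem_left _ _ (Ideal.mem_span_singleton_self _)
    have h3 := add_mem h1 h2
    rwa [← add_mul, sub_add_cancel, one_mul] at h3
  · rw [Ideal.span_singleton_le_iff_mem]
    change augmentation p G _ = 0
    rw [koszul, map_add, map_mul, ht, map_sub, ha, map_one, sub_self, zero_mul, add_zero]

end Idempotent

/-! ### The twist as `M` with the action changed by `twistHom`. -/

section Twist

variable {p : ℕ} [Fact p.Prime] {G : Type u} [Group G] [TopologicalSpace G] (ψ : OpenChar p G)
  (M : Type v) [AddCommGroup M] [Module ℤ_[p] M]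

instance : Module ℤ_[p] (Twist ψ M) := inferInstanceAs (Module ℤ_[p] (M ⊗[ℤ_[p]] ℤ_[p]))

/-- The identification of `M` with its twist, `m ↦ m ⊗ 1`. -/
def twistEquiv : M ≃ₗ[ℤ_[p]] Twist ψ M := (TensorProduct.rid ℤ_[p] M).symm

variable [Module (IwasawaAlgebra p G) M] [IsScalarTower ℤ_[p] (IwasawaAlgebra p G) M]

theorem smul_twistEquiv (x : IwasawaAlgebra p G) (m : M) :
    x • twistEquiv ψ M m = twistEquiv ψ M (twistHom ψ x • m) :=
  LinearMap.rTensor_tmul ℤ_[p] (Algebra.lsmul ℤ_[p] ℤ_[p] M (twistHom ψ x)) _ _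

instance : IsScalarTower ℤ_[p] (IwasawaAlgebra p G) (Twist ψ M) where
  smul_assoc r x t := by
    obtain ⟨m, rfl⟩ := (twistEquiv ψ M).surjective t
    rw [smul_twistEquiv, smul_twistEquiv, _root_.map_smul (twistHom ψ), smul_assoc,
      _root_.map_smul (twistEquiv ψ M)]

end Twist

/-! ### Kernel and cokernel on the twist, compared with the eigenspace. -/

section Eigenspace

theorem isScalarTower_subgroup {p : ℕ} [Fact p.Prime] {G : Type u} [CommGroup G]
    [TopologicalSpace G] (Γ : Subgroup G) (M : Type v) [AddCommGroup M] [Module ℤ_[p] M]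
    [Module (IwasawaAlgebra p G) M] [IsScalarTower ℤ_[p] (IwasawaAlgebra p G) M]
    [Module (IwasawaAlgebra p Γ) M] [IsScalarTower (IwasawaAlgebra p Γ) (IwasawaAlgebra p G) M] :
    IsScalarTower ℤ_[p] (IwasawaAlgebra p Γ) M where
  smul_assoc r x m := by
    rw [← algebraMap_smul (IwasawaAlgebra p G), algebraMap_smul_one, smul_assoc,
      algebraMap_smul]

variable {p : ℕ} [Fact p.Prime] {G : Type u} [CommGroup G] [TopologicalSpace G]
  [IsTopologicalGroup G] {Γ Δ : Subgroup G}
  (hc : Δ.IsComplement' Γ) (ho : IsOpen (Γ : Set G)) (χ : Δ →* ℤ_[p]ˣ)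

theorem twistHom_of_mem (δ : Δ) : twistHom (inflate hc ho χ) (of p (δ : G)) =
    (χ δ : ℤ_[p]) • of p (δ : G) := by
  have := inflate_apply hc ho χ 1 δ
  rw [OneMemClass.coe_one, one_mul] at this
  rw [twistHom_of, this]

theorem twistHom_algebraMap_of (γ : Γ) :
    twistHom (inflate hc ho χ) (algebraMap (IwasawaAlgebra p Γ) _ (of p γ - 1)) =
      algebraMap (IwasawaAlgebra p Γ) _ (of p γ - 1) := by
  have := inflate_apply hc ho χ γ 1
  rw [OneMemClass.coe_one, mul_one, map_one] at this
  rw [map_sub, map_sub, map_one, map_one, algebraMap_of, twistHom_of, this, Units.val_one, one_smul]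

variable [Fintype Δ] (M : Type v) [AddCommGroup M] [Module ℤ_[p] M]
  [Module (IwasawaAlgebra p G) M] [IsScalarTower ℤ_[p] (IwasawaAlgebra p G) M]

variable {M} in
-- Twisting the identity `e δ = e` gives `χ(δ) δ e' = e'` for the twisted idempotent `e'`, so `δ`
-- acts on `e' M` by `χ(δ)⁻¹`.
theorem twistHom_averaging_smul_mem (m : M) :
    twistHom (inflate hc ho χ) (averaging p Δ) • m ∈ eigenspace χ⁻¹ M := by
  intro δ
  have h := congrArg (twistHom (inflate hc ho χ)) (averaging_mul_of (p := p) δ)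
  rw [map_mul, twistHom_of_mem, mul_smul_comm] at h
  nth_rw 2 [← h]
  rw [smul_assoc, smul_smul, smul_smul, MonoidHom.inv_apply, Units.inv_mul, one_smul, mul_comm]

variable {M} in
theorem twistHom_averaging_smul (hΔ : IsUnit (Fintype.card Δ : ℤ_[p])) {m : M}
    (hm : m ∈ eigenspace χ⁻¹ M) : twistHom (inflate hc ho χ) (averaging p Δ) • m = m := by
  have h (δ : Δ) : twistHom (inflate hc ho χ) (of p (δ : G)) • m = m := by
    rw [twistHom_of_mem, smul_assoc, hm δ, smul_smul, MonoidHom.inv_apply, Units.mul_inv, one_smul]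
  rw [averaging, map_smul, map_sum, smul_assoc, Finset.sum_smul,
    Finset.sum_congr rfl fun δ _ => h δ,
    Finset.sum_const, Finset.card_univ, ← Nat.cast_smul_eq_nsmul ℤ_[p], smul_smul,
    Ring.inverse_mul_cancel _ hΔ, one_smul]

theorem one_sub_twistHom_averaging_mul_koszul (hΔ : IsUnit (Fintype.card Δ : ℤ_[p]))
    (t : IwasawaAlgebra p G) :
    (1 - twistHom (inflate hc ho χ) (averaging p Δ)) * twistHom (inflate hc ho χ) (koszul Δ t) =
      1 - twistHom (inflate hc ho χ) (averaging p Δ) := by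
  have := congrArg (twistHom (inflate hc ho χ)) (one_sub_averaging_mul_koszul hΔ t)
  simpa only [map_mul, map_sub, map_one] using this

variable {M} in
-- The twisted `koszul` element does nothing to the complementary component: `(1 - e') m = (1 - e')
-- x = 0`.
theorem mem_eigenspace_of_koszul_smul_eq (hΔ : IsUnit (Fintype.card Δ : ℤ_[p]))
    {t : IwasawaAlgebra p G} {m x : M} (hx : x ∈ eigenspace χ⁻¹ M)
    (h : twistHom (inflate hc ho χ) (koszul Δ t) • m = x) : m ∈ eigenspace χ⁻¹ M := by
  have h1 : (1 - twistHom (inflate hc ho χ) (averaging p Δ)) • m = 0 := by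
    rw [← one_sub_twistHom_averaging_mul_koszul hc ho χ hΔ t, mul_smul, h, sub_smul, one_smul,
      twistHom_averaging_smul hc ho χ hΔ hx, sub_self]
  rw [sub_smul, one_smul, sub_eq_zero] at h1
  rw [h1]
  exact twistHom_averaging_smul_mem hc ho χ m

variable [Module (IwasawaAlgebra p Γ) M]
  [IsScalarTower (IwasawaAlgebra p Γ) (IwasawaAlgebra p G) M]

/-- The eigenspace is a quotient of `M` through the twisted idempotent, and `Λ(G)` is finite over
`Λ(Γ)`. -/
theorem finite_eigenspace (hc : Δ.IsComplement' Γ) (ho : IsOpen (Γ : Set G))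
    (hΔ : IsUnit (Fintype.card Δ : ℤ_[p])) (e : Γ ≃ₜ* Multiplicative ℤ_[p])
    [Module.Finite (IwasawaAlgebra p G) M] :
    Module.Finite (IwasawaAlgebra p Γ) (eigenspace χ⁻¹ M) := by
  let f : M →ₗ[IwasawaAlgebra p G] eigenspace χ⁻¹ M :=
    (LinearMap.lsmul _ M (twistHom (inflate hc ho χ) (averaging p Δ))).codRestrict _
      (twistHom_averaging_smul_mem hc ho χ)
  have h1 : Module.Finite (IwasawaAlgebra p G) (eigenspace χ⁻¹ M) :=
    Module.Finite.of_surjective f fun m =>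
      ⟨m, Subtype.ext (twistHom_averaging_smul hc ho χ hΔ m.2)⟩
  have := finite_iwasawa (p := p) e hc
  exact Module.Finite.trans (IwasawaAlgebra p G) _

variable {M} in
-- The twisted idempotent is `1` here, so `te + (1 - e)` reduces to `t`, which the twist fixes since
-- the character is trivial on `Γ`.
theorem twistHom_koszul_smul {γ : Γ} {m : M} (hΔ : IsUnit (Fintype.card Δ : ℤ_[p]))
    (hm : m ∈ eigenspace χ⁻¹ M) :
    twistHom (inflate hc ho χ) (koszul Δ (algebraMap _ (IwasawaAlgebra p G) (of p γ - 1))) • m =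
      (of p γ - 1) • m := by
  rw [koszul, map_add, map_mul, map_sub _ 1, map_one (twistHom _), add_smul, mul_smul,
    sub_smul 1, twistHom_averaging_smul hc ho χ hΔ hm, one_smul, sub_self, add_zero,
    twistHom_algebraMap_of, algebraMap_smul]

variable [IsScalarTower ℤ_[p] (IwasawaAlgebra p Γ) M]

theorem ker_twist (hΔ : IsUnit (Fintype.card Δ : ℤ_[p])) (γ : Γ) :
    Nonempty (LinearMap.ker (LinearMap.lsmul (IwasawaAlgebra p Γ) (eigenspace χ⁻¹ M)
      (of p γ - 1)) ≃ₗ[ℤ_[p]]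
        LinearMap.ker (LinearMap.lsmul (IwasawaAlgebra p G) (Twist (inflate hc ho χ) M)
          (koszul Δ (algebraMap _ _ (of p γ - 1))))) := by
  let f : LinearMap.ker (LinearMap.lsmul (IwasawaAlgebra p Γ) (eigenspace χ⁻¹ M)
      (of p γ - 1)) →ₗ[ℤ_[p]]
        LinearMap.ker (LinearMap.lsmul (IwasawaAlgebra p G) (Twist (inflate hc ho χ) M)
          (koszul Δ (algebraMap _ _ (of p γ - 1)))) :=
    { toFun := fun x => ⟨twistEquiv _ M x, by
        have h : (of p γ - 1) • (x : M) = 0 := congrArg Subtype.val x.2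
        rw [LinearMap.mem_ker, LinearMap.lsmul_apply, smul_twistEquiv,
          twistHom_koszul_smul hc ho χ hΔ x.1.2, h, map_zero]⟩
      map_add' := fun x y => Subtype.ext (map_add (twistEquiv (inflate hc ho χ) M) _ _)
      map_smul' := fun r x => Subtype.ext (_root_.map_smul (twistEquiv (inflate hc ho χ) M) r _) }
  refine ⟨LinearEquiv.ofBijective f ⟨fun x y h => ?_, fun ⟨y, hy⟩ => ?_⟩⟩
  · exact Subtype.ext (Subtype.ext ((twistEquiv _ M).injective (congrArg Subtype.val h)))
  · obtain ⟨m, rfl⟩ := (twistEquiv _ M).surjective y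
    rw [LinearMap.mem_ker, LinearMap.lsmul_apply, smul_twistEquiv,
      LinearEquiv.map_eq_zero_iff] at hy
    have hm := mem_eigenspace_of_koszul_smul_eq hc ho χ hΔ (zero_mem _) hy
    rw [twistHom_koszul_smul hc ho χ hΔ hm] at hy
    exact ⟨⟨⟨m, hm⟩, Subtype.ext hy⟩, rfl⟩

theorem coker_twist (hΔ : IsUnit (Fintype.card Δ : ℤ_[p])) (γ : Γ) :
    Nonempty ((eigenspace χ⁻¹ M ⧸ LinearMap.range
      (LinearMap.lsmul (IwasawaAlgebra p Γ) (eigenspace χ⁻¹ M) (of p γ - 1))) ≃ₗ[ℤ_[p]]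
        (Twist (inflate hc ho χ) M ⧸ LinearMap.range
          (LinearMap.lsmul (IwasawaAlgebra p G) (Twist (inflate hc ho χ) M)
            (koszul Δ (algebraMap _ _ (of p γ - 1)))))) := by
  let R := LinearMap.range (LinearMap.lsmul (IwasawaAlgebra p G) (Twist (inflate hc ho χ) M)
    (koszul Δ (algebraMap _ _ (of p γ - 1))))
  let S := LinearMap.range (LinearMap.lsmul (IwasawaAlgebra p Γ) (eigenspace χ⁻¹ M) (of p γ - 1))
  let f : eigenspace χ⁻¹ M →ₗ[ℤ_[p]] Twist (inflate hc ho χ) M ⧸ R :=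
    (R.mkQ.restrictScalars ℤ_[p]).comp
      ((twistEquiv _ M).toLinearMap.comp ((eigenspace χ⁻¹ M).subtype.restrictScalars ℤ_[p]))
  have hR (m : M) : twistEquiv (inflate hc ho χ) M m ∈ R ↔
      ∃ m', twistHom (inflate hc ho χ) (koszul Δ (algebraMap _ _ (of p γ - 1))) • m' = m := by
    constructor
    · rintro ⟨y, hy⟩
      obtain ⟨m', rfl⟩ := (twistEquiv _ M).surjective y
      rw [LinearMap.lsmul_apply, smul_twistEquiv] at hy
      exact ⟨m', (twistEquiv _ M).injective hy⟩
    · rintro ⟨m', rfl⟩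
      exact ⟨twistEquiv _ M m', smul_twistEquiv _ M _ _⟩
  have hf : Function.Surjective f := by
    intro y
    obtain ⟨y, rfl⟩ := R.mkQ_surjective y
    obtain ⟨m, rfl⟩ := (twistEquiv _ M).surjective y
    refine ⟨⟨_, twistHom_averaging_smul_mem hc ho χ m⟩, (Submodule.Quotient.eq _).2 ?_⟩
    change twistEquiv _ M _ - _ ∈ R
    rw [← map_sub, hR]
    -- The difference is `e' m - m = -(1 - e') m`, and the twisted `koszul` element fixes `(1 - e')
    -- M`, so this vector is its own preimage.
    refine ⟨-((1 - twistHom (inflate hc ho χ) (averaging p Δ)) • m), ?_⟩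
    rw [smul_neg, smul_smul, mul_comm, one_sub_twistHom_averaging_mul_koszul hc ho χ hΔ, sub_smul,
      one_smul, neg_sub]
    rfl
  have hk : LinearMap.ker f = S.restrictScalars ℤ_[p] := by
    ext x
    refine ((Submodule.Quotient.mk_eq_zero R).trans (hR x)).trans ⟨?_, ?_⟩
    · rintro ⟨m, hm⟩
      have hm' := mem_eigenspace_of_koszul_smul_eq hc ho χ hΔ x.2 hm
      rw [twistHom_koszul_smul hc ho χ hΔ hm'] at hm
      exact ⟨⟨m, hm'⟩, Subtype.ext hm⟩
    · rintro ⟨m, rfl⟩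
      exact ⟨m, twistHom_koszul_smul hc ho χ hΔ m.2⟩
  exact ⟨(Submodule.Quotient.restrictScalarsEquiv ℤ_[p] S).symm.trans
    ((Submodule.quotEquivOfEq _ _ hk.symm).trans (f.quotKerEquivOfSurjective hf))⟩

end Eigenspace

/-! ### The two ranks in computable form. -/

section Rank

variable {p : ℕ} [Fact p.Prime] {G : Type u} [CommGroup G] [TopologicalSpace G]

theorem lambdaRank_eq_finrank [IsDomain (IwasawaAlgebra p G)] (N : Type v) [AddCommGroup N]
    [Module (IwasawaAlgebra p G) N] :
    lambdaRank p G N = Module.finrank (IwasawaAlgebra p G) N :=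
  (TensorProduct.isBaseChange (IwasawaAlgebra p G) N
    (FractionRing (IwasawaAlgebra p G))).finrank_eq

variable [Small.{v} (IwasawaAlgebra p G)] {N : Type v} [AddCommGroup N]
  [Module (IwasawaAlgebra p G) N]

/-- If the homology vanishes above degree one, then the homological rank is the difference of the
ranks in degrees zero and one. -/
theorem hmrank_eq_sub [Module.Finite ℤ_[p] (homology p G N 0)]
    [Module.Finite ℤ_[p] (homology p G N 1)] (h : ∀ i, Subsingleton (homology p G N (i + 2))) :
    HasFiniteHomologicalRank p G N ∧ hmrank p G N =
      (Module.finrank ℤ_[p] (homology p G N 0) : ℤ) - Module.finrank ℤ_[p] (homology p G N 1) := by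
  have h2 (i : ℕ) (hi : i ∉ ({0, 1} : Finset ℕ)) : Subsingleton (homology p G N i) := by
    obtain ⟨j, rfl⟩ : ∃ j, i = j + 2 := ⟨i - 2, by simp at hi; omega⟩
    exact h j
  refine ⟨⟨fun i => ?_, ({0, 1} : Finset ℕ).finite_toSet.subset fun i hi => ?_⟩, ?_⟩
  · match i with
    | 0 => exact Module.rank_lt_aleph0 _ _
    | 1 => exact Module.rank_lt_aleph0 _ _
    | i + 2 =>
      have := h i
      exact Module.rank_lt_aleph0 _ _
  · by_contra hi'
    have := h2 i hi'
    exact hi (rank_subsingleton' _ _)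
  · rw [hmrank, finsum_eq_sum_of_support_subset _ (s := {0, 1}), Finset.sum_pair zero_ne_one]
    · ring
    · intro i hi
      by_contra hi'
      have := h2 i hi'
      exact hi (by simp [Module.finrank_zero_of_subsingleton])

end Rank

end

end Iwasawa

/-! ### Comparison of the two ranks. -/

theorem mainTheorem8 {p : ℕ} [Fact p.Prime] (hp : 3 ≤ p)
    {G : Type u} [CommGroup G] [TopologicalSpace G] [IsTopologicalGroup G]
    (hG : Nonempty (G ≃ₜ* ℤ_[p]ˣ))
    (Γ Δ : Subgroup G) (hc : Δ.IsComplement' Γ) (ho : IsOpen (Γ : Set G))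
    (hΓ : Nonempty (Γ ≃ₜ* Multiplicative ℤ_[p])) (hΔ : Nonempty (Δ ≃* (ZMod p)ˣ))
    (χ : Δ →* ℤ_[p]ˣ)
    (M : Type (max u v)) [AddCommGroup M] [Module ℤ_[p] M] [Module (Iwasawa.IwasawaAlgebra p G) M]
    [IsScalarTower ℤ_[p] (Iwasawa.IwasawaAlgebra p G) M]
    [Module (Iwasawa.IwasawaAlgebra p Γ) M] [IsScalarTower (Iwasawa.IwasawaAlgebra p Γ) (Iwasawa.IwasawaAlgebra p G) M]
    [Module.Finite (Iwasawa.IwasawaAlgebra p G) M] :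
    Iwasawa.HasFiniteHomologicalRank p G (Iwasawa.Twist (Iwasawa.inflate hc ho χ) M) ∧
    Module.Finite (Iwasawa.IwasawaAlgebra p Γ) (Iwasawa.eigenspace χ⁻¹ M) ∧
    Iwasawa.hmrank p G (Iwasawa.Twist (Iwasawa.inflate hc ho χ) M) = (Iwasawa.lambdaRank p Γ (Iwasawa.eigenspace χ⁻¹ M) : ℤ) := by
  obtain ⟨e⟩ := hΓ
  obtain ⟨eΔ⟩ := hΔ
  let _ : Fintype Δ := Fintype.ofEquiv _ eΔ.symm.toEquiv
  -- The order of `Δ` is `p - 1`, which is prime to `p`.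
  have hu : IsUnit (Fintype.card Δ : ℤ_[p]) := by
    rw [Fintype.card_congr eΔ.toEquiv, ZMod.card_units, PadicInt.isUnit_iff,
      PadicInt.norm_natCast_eq_one_iff]
    exact (Nat.coprime_self_sub_right (by omega)).2 (Nat.coprime_one_right p)
  have := Iwasawa.isScalarTower_subgroup (p := p) Γ M
  have hfin := Iwasawa.finite_eigenspace χ M hc ho hu e
  have := Iwasawa.isDomain_iwasawa (p := p) e
  have := Iwasawa.isNoetherianRing_iwasawa (p := p) e
  have hres := Iwasawa.isResidueRing_iwasawa (p := p) e
  have hreg := Iwasawa.isRegular_koszul hu e hc ho (Iwasawa.generator_sub_one_ne_zero e)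
  have hI := Iwasawa.augmentationIdeal_eq_span_koszul hu e hc
  obtain ⟨f₀⟩ := Iwasawa.homology_zero (N := Iwasawa.Twist (Iwasawa.inflate hc ho χ) M) hreg hI
  obtain ⟨f₁⟩ := Iwasawa.homology_one (N := Iwasawa.Twist (Iwasawa.inflate hc ho χ) M) hreg hI
  obtain ⟨g₀⟩ := Iwasawa.coker_twist hc ho χ M hu (Iwasawa.generator e)
  obtain ⟨g₁⟩ := Iwasawa.ker_twist hc ho χ M hu (Iwasawa.generator e)
  -- `k₀` and `k₁` identify the cokernel and kernel of `γ - 1` on the eigenspace with `H₀` and `H₁`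
  -- of the twist.
  have k₀ := g₀.trans f₀.symm
  have k₁ := g₁.trans f₁.symm
  have := hres.finite_coker (N := Iwasawa.eigenspace χ⁻¹ M)
  have := hres.finite_ker (N := Iwasawa.eigenspace χ⁻¹ M)
  have := Module.Finite.equiv k₀
  have := Module.Finite.equiv k₁
  obtain ⟨h, h'⟩ := Iwasawa.hmrank_eq_sub
    (Iwasawa.homology_add_two (N := Iwasawa.Twist (Iwasawa.inflate hc ho χ) M) hreg hI)
  refine ⟨h, hfin, ?_⟩
  rw [h', Iwasawa.lambdaRank_eq_finrank, ← k₀.finrank_eq, ← k₁.finrank_eq,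
    hres.finrank_coker (Iwasawa.generator_sub_one_ne_zero e)]
  push_cast
  ring
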